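/- Let $d_u,d_\ell,k\in\mathbb N$, $A\in\mathbb R^{k\times d_\ell}$, $B\in\mathbb R^{k\times d_u}$, $\mathbf b\in\mathbb R^k$, let $g:\mathbb R^{d_u}\times\mathbb R^{d_\ell}\to\mathbb R$, and let $f(\mathbf x,\mathbf y)=\mathbb E_{\xi\sim\mathcal D_f}[\widetilde f(\mathbf x,\mathbf y;\xi)]$, where $\widetilde f(\mathbf x,\mathbf y;\cdot)$ is integrable for all $\mathbf x,\mathbf y$. Let $\mathcal Q$ be a probability distribution on $\mathbb R^{d_\ell}$ that is absolutely continuous with respect to Lebesgue measure. Write $\mathcal Y(\mathbf x)=\{\mathbf y: A\mathbf y+B\mathbf x\le\mathbf b\}$ and, for $\mathbf q\in\mathbb R^{d_\ell}$, $$\mathbf y_q^*(\mathbf x)=\operatorname*{arg\,min}_{\mathbf y\in\mathcal Y(\mathbf x)}\ g_q(\mathbf x,\mathbf y),\qquad g_q(\mathbf x,\mathbf y)=g(\mathbf x,\mathbf y)+\mathbf q^\top\mathbf y .$$ Let $S_q(\mathbf x)\subseteq\{1,\dots,k\}$ be the set of constraints active (holding with equality) at $\mathbf y_q^*(\mathbf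 x)$, and let $\overline A,\overline B$ consist of the rows of $A,B$ with index in $S_q(\mathbf x)$. Assume: 1. $f$ is once and $g$ is twice continuously differentiable; $\mathcal Y(\mathbf x)$ is compact for every $\mathbf x\in\mathbb R^{d_u}$; there is $\mu_g>0$ such that $g(\mathbf x,\cdot)$ is $\mu_g$-strongly convex for every $\mathbf x\in\mathbb R^{d_u}$. 2. For every $\mathbf x\in\mathbb R^{d_u}$ there is $\mathbf y$ with $A\mathbf y+B\mathbf x<\mathbf b$; and for every $\mathbf x\in\mathbb R^{d_u}$ and almost every $\mathbf q\sim\mathcal Q$ the matrix $\overline A$ has full row rank. Put $F_q(\mathbf x)=f(\mathbf x,\mathbf y_q^*(\mathbf x))$, $F_q(\mathbf x;\xi)=\widetilde f(\mathbf x,\mathbf y_q^*(\mathbf x);\xi)$, $\overline F(\mathbf x)=\mathbb E_{\mathbf q\sim\mathcal Q}[F_q(\mathbf x)]$ and $\overline F(\mathbf x,\xi)=\mathbb E_{\mathbf q\sim\mathcal Q}[F_q(\mathbf x;\xi)]$. Let $\boldsymbol\lambda_q^*(\mathbf x)\in\mathbb R^k$ be the vector of Lagrange (KKT) multipliers of the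 constraints at $\mathbf y_q^*(\mathbf x)$. Then for every $\mathbf x\in\mathbb R^{d_u}$ the function $\overline F$ is differentiable at $\mathbf x$, and for every $\xi$ such that $\widetilde f(\cdot,\cdot;\xi)$ is continuously differentiable the function $\overline F(\cdot,\xi)$ is differentiable at $\mathbf x$. The expectations involved exist, and $$\nabla\overline F(\mathbf x)=\mathbb E_{\mathbf q\sim\mathcal Q}[\nabla F_q(\mathbf x)],\qquad \nabla\overline F(\mathbf x,\xi)=\mathbb E_{\mathbf q\sim\mathcal Q}[\nabla F_q(\mathbf x;\xi)].$$ Moreover, for every such $\mathbf x$ (and $\xi$) and almost every $\mathbf q\sim\mathcal Q$, the functions $F_q$, $F_q(\cdot;\xi)$, $\mathbf y_q^*$ and $\overline{\boldsymbol\lambda}_q^*$ are differentiable at $\mathbf x$, where $\overline{\boldsymbol\lambda}_q^*(\cdot)$ is the subvector of $\boldsymbol\lambda_q^*(\cdot)$ with the (fixed) indices $S_q(\mathbf x)$. With $H=\nabla^2_{yy}g(\mathbf x,\mathbf y_q^*(\mathbf x))$ and with $\nabla^2_{xy}g\in\mathbb R^{d_\ell\times d_u}$ the Jacobian in $\mathbf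 x$ of $\nabla_yg$, the matrices $H$ and $\overline AH^{-1}\overline A^\top$ are invertible, and $$\nabla F_q(\mathbf x)=\nabla_xf(\mathbf x,\mathbf y_q^*(\mathbf x))+[\nabla\mathbf y_q^*(\mathbf x)]^\top\nabla_yf(\mathbf x,\mathbf y_q^*(\mathbf x)),$$ $$\nabla F_q(\mathbf x;\xi)=\nabla_x\widetilde f(\mathbf x,\mathbf y_q^*(\mathbf x);\xi)+[\nabla\mathbf y_q^*(\mathbf x)]^\top\nabla_y\widetilde f(\mathbf x,\mathbf y_q^*(\mathbf x);\xi),$$ $$\nabla\mathbf y_q^*(\mathbf x)=H^{-1}\big[-\nabla^2_{xy}g(\mathbf x,\mathbf y_q^*(\mathbf x))-\overline A^\top\nabla\overline{\boldsymbol\lambda}_q^*(\mathbf x)\big],$$ $$\nabla\overline{\boldsymbol\lambda}_q^*(\mathbf x)=-\big[\overline AH^{-1}\overline A^\top\big]^{-1}\big[\overline AH^{-1}\nabla^2_{xy}g(\mathbf x,\mathbf y_q^*(\mathbf x))-\overline B\big].$$ -/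

import Mathlib

open MeasureTheory
open scoped Matrix

noncomputable section

namespace BilevelLC

/-- The Jacobian matrix `(∂ F_i / ∂ x_j)_{i j}` of a map between Euclidean spaces. -/
def jacobian {m n : Type*} [Fintype m] [Fintype n] [DecidableEq n]
    (F : EuclideanSpace ℝ n → EuclideanSpace ℝ m) (x : EuclideanSpace ℝ n) : Matrix m n ℝ :=
  Matrix.of fun i j => fderiv ℝ F x (EuclideanSpace.single j 1) i

section PartialDerivatives

variable {du dl : ℕ}

/-- The partial gradient `∇_x f(x, y)`. -/
def gradX (f : EuclideanSpace ℝ (Fin du) → EuclideanSpace ℝ (Fin dl) → ℝ)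
    (x : EuclideanSpace ℝ (Fin du)) (y : EuclideanSpace ℝ (Fin dl)) :
    EuclideanSpace ℝ (Fin du) :=
  gradient (fun x' => f x' y) x

/-- The partial gradient `∇_y f(x, y)`. -/
def gradY (f : EuclideanSpace ℝ (Fin du) → EuclideanSpace ℝ (Fin dl) → ℝ)
    (x : EuclideanSpace ℝ (Fin du)) (y : EuclideanSpace ℝ (Fin dl)) :
    EuclideanSpace ℝ (Fin dl) :=
  gradient (fun y' => f x y') y

/-- The Hessian `∇²_{yy} g(x, y)`, the Jacobian of `∇_y g` in `y`. -/
def hessYY (g : EuclideanSpace ℝ (Fin du) → EuclideanSpace ℝ (Fin dl) → ℝ)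
    (x : EuclideanSpace ℝ (Fin du)) (y : EuclideanSpace ℝ (Fin dl)) :
    Matrix (Fin dl) (Fin dl) ℝ :=
  jacobian (fun y' => gradY g x y') y

/-- The mixed derivative `∇²_{xy} g(x, y)`, the `dl × du` Jacobian of `∇_y g` in `x`. -/
def hessXY (g : EuclideanSpace ℝ (Fin du) → EuclideanSpace ℝ (Fin dl) → ℝ)
    (x : EuclideanSpace ℝ (Fin du)) (y : EuclideanSpace ℝ (Fin dl)) :
    Matrix (Fin dl) (Fin du) ℝ :=
  jacobian (fun x' => gradY g x' y) x

end PartialDerivatives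

/-- The data of a lower-level problem `min_y g(x, y)` subject to `A y + B x ≤ b`. -/
structure LowerLevel (du dl k : ℕ) where
  g : EuclideanSpace ℝ (Fin du) → EuclideanSpace ℝ (Fin dl) → ℝ
  A : Matrix (Fin k) (Fin dl) ℝ
  B : Matrix (Fin k) (Fin du) ℝ
  b : Fin k → ℝ

namespace LowerLevel

variable {du dl k : ℕ} (P : LowerLevel du dl k)

/-- The feasible set `{y : A y + B x ≤ b}`. -/
def feasible (x : EuclideanSpace ℝ (Fin du)) : Set (EuclideanSpace ℝ (Fin dl)) :=
  {y | ∀ i, (P.A *ᵥ y.ofLp) i + (P.B *ᵥ x.ofLp) i ≤ P.b i}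

/-- The perturbed objective `g_q(x, y) = g(x, y) + qᵀ y`. -/
def perturbed (q : EuclideanSpace ℝ (Fin dl)) (x : EuclideanSpace ℝ (Fin du))
    (y : EuclideanSpace ℝ (Fin dl)) : ℝ :=
  P.g x y + inner ℝ q y

/-- `y` minimizes `g_q(x, ·)` over the feasible set. -/
def IsSolution (q : EuclideanSpace ℝ (Fin dl)) (x : EuclideanSpace ℝ (Fin du))
    (y : EuclideanSpace ℝ (Fin dl)) : Prop :=
  y ∈ P.feasible x ∧ IsMinOn (P.perturbed q x) (P.feasible x) y

/-- The solution `y_q*(x)`. It exists and is unique when the feasible set is nonempty and compact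
and `g(x, ·)` is continuous and strongly convex (the value is arbitrary if there is none). -/
def ystar (q : EuclideanSpace ℝ (Fin dl)) (x : EuclideanSpace ℝ (Fin du)) :
    EuclideanSpace ℝ (Fin dl) :=
  Classical.epsilon (P.IsSolution q x)

/-- The set `S(y)` of constraints that are active at `y`. -/
def active (x : EuclideanSpace ℝ (Fin du)) (y : EuclideanSpace ℝ (Fin dl)) : Finset (Fin k) :=
  Finset.univ.filter fun i => (P.A *ᵥ y.ofLp) i + (P.B *ᵥ x.ofLp) i = P.b i

/-- The active constraints at `y_q*(x)`. -/
abbrev activeStar (q : EuclideanSpace ℝ (Fin dl)) (x : EuclideanSpace ℝ (Fin du)) :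
    Finset (Fin k) :=
  P.active x (P.ystar q x)

/-- The rows `Ā` of `A` that are active at `y_q*(x)`. -/
def Abar (q : EuclideanSpace ℝ (Fin dl)) (x : EuclideanSpace ℝ (Fin du)) :
    Matrix (P.activeStar q x) (Fin dl) ℝ :=
  P.A.submatrix (fun i => (i : Fin k)) id

/-- The rows `B̄` of `B` that are active at `y_q*(x)`. -/
def Bbar (q : EuclideanSpace ℝ (Fin dl)) (x : EuclideanSpace ℝ (Fin du)) :
    Matrix (P.activeStar q x) (Fin du) ℝ :=
  P.B.submatrix (fun i => (i : Fin k)) id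

/-- `l` is a vector of Lagrange multipliers for `y`: `(y, l)` satisfies the KKT conditions of
the perturbed lower-level problem. -/
def IsMultiplier (q : EuclideanSpace ℝ (Fin dl)) (x : EuclideanSpace ℝ (Fin du))
    (y : EuclideanSpace ℝ (Fin dl)) (l : Fin k → ℝ) : Prop :=
  (gradY (P.perturbed q) x y).ofLp + P.Aᵀ *ᵥ l = 0 ∧
    (∀ i, l i * ((P.A *ᵥ y.ofLp) i + (P.B *ᵥ x.ofLp) i - P.b i) = 0) ∧
    (∀ i, 0 ≤ l i) ∧
    y ∈ P.feasible x

/-- The multipliers `λ_q*(x)` of `y_q*(x)`, unique when `Ā` has full row rank. -/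
def multiplier (q : EuclideanSpace ℝ (Fin dl)) (x : EuclideanSpace ℝ (Fin du)) : Fin k → ℝ :=
  Classical.epsilon (P.IsMultiplier q x (P.ystar q x))

/-- The subvector of `λ_q*(x)` with indices in `S`; for `S` the active set at `y_q*(x)` this is
the vector of multipliers of the active constraints. -/
def multiplierOn (S : Finset (Fin k)) (q : EuclideanSpace ℝ (Fin dl))
    (x : EuclideanSpace ℝ (Fin du)) : EuclideanSpace ℝ S :=
  WithLp.toLp 2 fun i => P.multiplier q x i

/-- `H = ∇²_{yy} g(x, y_q*(x))`. -/
def H (q : EuclideanSpace ℝ (Fin dl)) (x : EuclideanSpace ℝ (Fin du)) :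
    Matrix (Fin dl) (Fin dl) ℝ :=
  hessYY P.g x (P.ystar q x)

/-- `M = ∇²_{xy} g(x, y_q*(x))`. -/
def M (q : EuclideanSpace ℝ (Fin dl)) (x : EuclideanSpace ℝ (Fin du)) :
    Matrix (Fin dl) (Fin du) ℝ :=
  hessXY P.g x (P.ystar q x)

/-- The function `F_q(x) = f(x, y_q*(x))`. -/
def implicitFun (f : EuclideanSpace ℝ (Fin du) → EuclideanSpace ℝ (Fin dl) → ℝ)
    (q : EuclideanSpace ℝ (Fin dl)) (x : EuclideanSpace ℝ (Fin du)) : ℝ :=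
  f x (P.ystar q x)

/-- The perturbed implicit function `F̄(x) = E_{q ∼ Q} [f(x, y_q*(x))]`. -/
def smoothedFun (f : EuclideanSpace ℝ (Fin du) → EuclideanSpace ℝ (Fin dl) → ℝ)
    (Q : Measure (EuclideanSpace ℝ (Fin dl))) (x : EuclideanSpace ℝ (Fin du)) : ℝ :=
  ∫ q, P.implicitFun f q x ∂Q

end LowerLevel

end BilevelLC

end

open BilevelLC

/-! For fixed `q` the solution map is only piecewise smooth: it has kinks where the active set
changes. The random linear term makes such a kink at a given `x` a null event, and a Lipschitz bound
uniform in `q` permits differentiation under the expectation.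

Null event: if an active constraint `i` has zero multiplier, stationarity writes `q` as `-∇_y g(x,
y) - w`, with `w` in the span of the other active rows and `y` on the affine set these rows cut out.
The pairs `(y, w)` form a space of full dimension, but activity of `i` confines them to a
hyperplane, and a differentiable map sends null sets to null sets (`volume_degenerate_eq_zero`). As
`Q ≪ volume`, strict complementarity holds `Q`-almost surely (`ae_strict_complementarity`).

Pointwise derivative: under independence and strict complementarity the active set is locally
constant, so the increments of solution and multipliers solve the linearized KKT system up to the
Taylor remainder of `∇_y g`. The solution map is locally Lipschitz, so that remainder is `o(‖x' -
x‖)`; block elimination (`saddle_point_solution`) then gives both Jacobians at once, without the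
implicit function theorem.

Uniform bound: strong convexity and KKT give an energy estimate (`energy_le`). By Carathéodory,
multipliers can be chosen with linearly independent support. Between parameters with the same
support the multiplier difference is controlled by the gradient difference, in which `q` cancels, so
the Lipschitz constant does not depend on `q`. There are finitely many supports, and
`norm_sub_le_of_finite_cover` joins these estimates along a segment (`exists_lipschitz_ystar`). -/

namespace BilevelLC

open Filter Topology Set Asymptotics

/-! ### Finitely generated cones, Farkas' lemma and KKT multipliers. -/

section Cones

variable {ι E : Type*}

/-- Coefficient vectors supported in `S`. -/
def supportedIn (S : Finset ι) : Submodule ℝ (ι → ℝ) where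
  carrier := {c | ∀ i ∉ S, c i = 0}
  zero_mem' := by simp
  add_mem' := by
    intro c d hc hd i hi
    simp [hc i hi, hd i hi]
  smul_mem' := by
    intro r c hc i hi
    simp [hc i hi]

variable [Fintype ι]

section Algebra

variable [AddCommGroup E] [Module ℝ E]

theorem sum_smul_eq_sum_of_supported {a : ι → E} {S : Finset ι} {c : ι → ℝ}
    (hc : ∀ i ∉ S, c i = 0) : ∑ i, c i • a i = ∑ i ∈ S, c i • a i := by
  refine (Finset.sum_subset (Finset.subset_univ S) fun i _ hi => ?_).symm
  rw [hc i hi, zero_smul]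

theorem eq_zero_of_supported_of_sum_eq_zero {a : ι → E} {S : Finset ι}
    (hS : LinearIndepOn ℝ a (S : Set ι)) {c : ι → ℝ} (hc : ∀ i ∉ S, c i = 0)
    (h : ∑ i, c i • a i = 0) : c = 0 := by
  rw [sum_smul_eq_sum_of_supported hc] at h
  rw [linearIndepOn_finset_iff] at hS
  funext i
  by_cases hi : i ∈ S
  · exact hS c h i hi
  · exact hc i hi

/-- Carathéodory's theorem for cones. -/
theorem exists_linearIndepOn_nonneg_combination (a : ι → E) (S : Finset ι) :
    ∀ c : ι → ℝ, (∀ i, 0 ≤ c i) → (∀ i ∉ S, c i = 0) →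
      ∃ T ⊆ S, ∃ c' : ι → ℝ, LinearIndepOn ℝ a (T : Set ι) ∧ (∀ i, 0 ≤ c' i) ∧
        (∀ i ∉ T, c' i = 0) ∧ ∑ i, c' i • a i = ∑ i, c i • a i := by
  classical
  induction S using Finset.strongInduction with
  | H S ih =>
    intro c hc hcS
    by_cases hS : LinearIndepOn ℝ a (S : Set ι)
    · exact ⟨S, subset_rfl, c, hS, hc, hcS, rfl⟩
    rw [linearIndepOn_finset_iff] at hS
    push Not at hS
    obtain ⟨d₀, hd₀, j₀, hj₀S, hj₀⟩ := hS
    -- A dependence relation, with its sign flipped if necessary so that some coefficient is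
    -- positive.
    obtain ⟨d, hdS, hd, j, hjS, hj⟩ : ∃ d : ι → ℝ, (∀ i ∉ S, d i = 0) ∧
        ∑ i, d i • a i = 0 ∧ ∃ j ∈ S, 0 < d j := by
      rcases hj₀.lt_or_gt with h | h
      · refine ⟨fun i => if i ∈ S then -d₀ i else 0, fun i hi => by simp [hi], ?_, j₀, hj₀S,
          by simp [hj₀S, h]⟩
        rw [sum_smul_eq_sum_of_supported (S := S) (fun i hi => by simp [hi]),
          Finset.sum_congr rfl (fun i hi => by rw [if_pos hi, neg_smul]),
          Finset.sum_neg_distrib, hd₀, neg_zero]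
      · refine ⟨fun i => if i ∈ S then d₀ i else 0, fun i hi => by simp [hi], ?_, j₀, hj₀S,
          by simp [hj₀S, h]⟩
        rw [sum_smul_eq_sum_of_supported (S := S) (fun i hi => by simp [hi]),
          Finset.sum_congr rfl (fun i hi => by rw [if_pos hi]), hd₀]
    -- Ratio test: `c m / d m` is the largest `t` keeping `c - t d` nonnegative, and it annihilates
    -- the coefficient at `m`.
    obtain ⟨m, hm, hmin⟩ := (S.filter fun i => 0 < d i).exists_min_image (fun i => c i / d i)
      ⟨j, by simp [hjS, hj]⟩
    rw [Finset.mem_filter] at hm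
    have ht : 0 ≤ c m / d m := div_nonneg (hc m) hm.2.le
    have hnonneg : ∀ i, 0 ≤ c i - c m / d m * d i := by
      intro i
      rcases le_or_gt (d i) 0 with h | h
      · have := mul_nonpos_of_nonneg_of_nonpos ht h
        have := hc i
        linarith
      · have hiS : i ∈ S := by
          by_contra hi
          exact h.ne' (hdS i hi)
        have := hmin i (by simp [hiS, h])
        rw [le_div_iff₀ h] at this
        linarith
    have hsupp : ∀ i ∉ S.erase m, c i - c m / d m * d i = 0 := by
      intro i hi
      rw [Finset.mem_erase, not_and_or, not_not] at hi
      rcases hi with rfl | hi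
      · rw [div_mul_cancel₀ _ hm.2.ne', sub_self]
      · rw [hcS i hi, hdS i hi, mul_zero, sub_zero]
    obtain ⟨T, hT, c', h1, h2, h3, h4⟩ := ih (S.erase m) (Finset.erase_ssubset hm.1)
      (fun i => c i - c m / d m * d i) hnonneg hsupp
    refine ⟨T, hT.trans (Finset.erase_subset _ _), c', h1, h2, h3, h4.trans ?_⟩
    simp only [sub_smul, mul_smul, Finset.sum_sub_distrib, ← Finset.smul_sum, hd, smul_zero,
      sub_zero]

end Algebra

section Normed

variable [NormedAddCommGroup E] [NormedSpace ℝ E]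

/-- The map sending a coefficient vector supported in `S` to the linear combination. -/
noncomputable def combination (a : ι → E) (S : Finset ι) : supportedIn S →ₗ[ℝ] E :=
  (Fintype.linearCombination ℝ a).domRestrict (supportedIn S)

theorem combination_apply (a : ι → E) (S : Finset ι) (c : supportedIn S) :
    combination a S c = ∑ i, (c : ι → ℝ) i • a i := rfl

theorem combination_ker {a : ι → E} {S : Finset ι} (hS : LinearIndepOn ℝ a (S : Set ι)) :
    LinearMap.ker (combination a S) = ⊥ := by
  refine LinearMap.ker_eq_bot'.2 fun c hc => ?_
  exact Subtype.ext (eq_zero_of_supported_of_sum_eq_zero hS c.2 hc)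

/-- Coefficients of linearly independent families are bounded by the linear combination. -/
theorem exists_norm_le_norm_sum_smul (a : ι → E) :
    ∃ K : ℝ, 0 ≤ K ∧ ∀ S : Finset ι, LinearIndepOn ℝ a (S : Set ι) → ∀ c : ι → ℝ,
      (∀ i ∉ S, c i = 0) → ‖c‖ ≤ K * ‖∑ i, c i • a i‖ := by
  classical
  have key : ∀ S : Finset ι, ∃ K : ℝ, 0 ≤ K ∧ (LinearIndepOn ℝ a (S : Set ι) →
      ∀ c : ι → ℝ, (∀ i ∉ S, c i = 0) → ‖c‖ ≤ K * ‖∑ i, c i • a i‖) := by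
    intro S
    by_cases hS : LinearIndepOn ℝ a (S : Set ι)
    · obtain ⟨K, -, hK⟩ := (combination a S).exists_antilipschitzWith (combination_ker hS)
      refine ⟨K, K.2, fun _ c hc => ?_⟩
      have := hK.le_mul_dist ⟨c, hc⟩ 0
      simpa [dist_zero_right, combination_apply] using this
    · exact ⟨0, le_rfl, fun h => absurd h hS⟩
  choose K hK0 hK using key
  refine ⟨∑ S, K S, Finset.sum_nonneg fun S _ => hK0 S, fun S hS c hc =>
    (hK S hS c hc).trans ?_⟩
  gcongr
  exact Finset.single_le_sum (f := K) (fun S _ => hK0 S) (Finset.mem_univ S)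

/-- Finitely generated cones are closed. -/
theorem isClosed_nonneg_combinations (a : ι → E) :
    IsClosed {v : E | ∃ c : ι → ℝ, (∀ i, 0 ≤ c i) ∧ v = ∑ i, c i • a i} := by
  classical
  -- By Carathéodory the cone is a finite union of images of closed orthants under injective linear
  -- maps, which are closed embeddings in finite dimension.
  have : {v : E | ∃ c : ι → ℝ, (∀ i, 0 ≤ c i) ∧ v = ∑ i, c i • a i} =
      ⋃ S ∈ {S : Finset ι | LinearIndepOn ℝ a (S : Set ι)},
        combination a S '' {c | ∀ i, 0 ≤ (c : ι → ℝ) i} := by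
    ext v
    simp only [mem_ofPred_eq, mem_iUnion, mem_image, exists_prop]
    constructor
    · rintro ⟨c, hc, rfl⟩
      obtain ⟨T, -, c', h1, h2, h3, h4⟩ :=
        exists_linearIndepOn_nonneg_combination a Finset.univ c hc (by simp)
      exact ⟨T, h1, ⟨c', h3⟩, h2, h4⟩
    · rintro ⟨S, -, c, hc, rfl⟩
      exact ⟨c, hc, rfl⟩
  rw [this]
  refine (Set.toFinite _).isClosed_biUnion fun S hS => ?_
  refine (LinearMap.isClosedEmbedding_of_injective (combination_ker hS)).isClosedMap _ ?_
  simp only [Set.ofPred_forall]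
  exact isClosed_iInter fun i => isClosed_le continuous_const
    ((continuous_apply i).comp continuous_subtype_val)

end Normed

section Inner

variable [NormedAddCommGroup E] [InnerProductSpace ℝ E] [FiniteDimensional ℝ E]

/-- **Farkas' lemma**: a vector making a nonnegative product with every `d` in the dual cone of the
`a i`, `i ∈ S`, is a nonnegative combination of linearly independent ones among them. -/
theorem farkas (a : ι → E) (S : Finset ι) (v : E)
    (h : ∀ d : E, (∀ i ∈ S, inner ℝ (a i) d ≤ 0) → inner ℝ v d ≤ 0) :
    ∃ T ⊆ S, ∃ c : ι → ℝ, LinearIndepOn ℝ a (T : Set ι) ∧ (∀ i, 0 ≤ c i) ∧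
      (∀ i ∉ T, c i = 0) ∧ v = ∑ i, c i • a i := by
  classical
  -- Zeroing the generators outside `S` keeps the index type, so closedness applies directly.
  set b : ι → E := fun i => if i ∈ S then a i else 0 with hb
  set C : Set E := {v : E | ∃ c : ι → ℝ, (∀ i, 0 ≤ c i) ∧ v = ∑ i, c i • b i} with hC
  have hv : v ∈ C := by
    by_contra hv
    have hconv : Convex ℝ C := by
      rintro _ ⟨c, hc, rfl⟩ _ ⟨d, hd, rfl⟩ s t hs ht -
      refine ⟨fun i => s * c i + t * d i, fun i => add_nonneg (mul_nonneg hs (hc i))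
        (mul_nonneg ht (hd i)), ?_⟩
      simp only [add_smul, mul_smul, Finset.sum_add_distrib, Finset.smul_sum]
    obtain ⟨f, u, hf, hu⟩ := geometric_hahn_banach_closed_point hconv
      (isClosed_nonneg_combinations b) hv
    have hu0 : 0 < u := by
      have := hf 0 ⟨0, by simp, by simp⟩
      simpa using this
    have hfb : ∀ i ∈ S, f (a i) ≤ 0 := by
      intro i hi
      by_contra! hpos
      -- This multiple of the generator has `f`-value exactly `u`, against the strict separation.
      have := hf ((u / f (a i)) • a i) ⟨Pi.single i (u / f (a i)), ?_, ?_⟩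
      · rw [map_smul, smul_eq_mul, div_mul_cancel₀ _ hpos.ne'] at this
        exact this.false
      · intro j
        rcases eq_or_ne j i with rfl | hj
        · simpa using div_nonneg hu0.le hpos.le
        · simp [hj]
      · rw [Finset.sum_eq_single i]
        · simp [hb, hi]
        · intro j _ hj
          simp [hj]
        · simp
    have := h ((InnerProductSpace.toDual ℝ E).symm f) fun i hi => by
      rw [real_inner_comm, InnerProductSpace.toDual_symm_apply]
      exact hfb i hi
    rw [real_inner_comm, InnerProductSpace.toDual_symm_apply] at this
    linarith
  obtain ⟨c, hc, rfl⟩ := hv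
  obtain ⟨T, hTS, c', h1, h2, h3, h4⟩ := exists_linearIndepOn_nonneg_combination a S
    (fun i => if i ∈ S then c i else 0)
    (fun i => by split_ifs <;> [exact hc i; exact le_rfl]) (fun i hi => by simp [hi])
  refine ⟨T, hTS, c', h1, h2, h3, h4.symm ▸ Finset.sum_congr rfl fun i _ => ?_⟩
  by_cases hi : i ∈ S <;> simp [hb, hi]

/-- Karush-Kuhn-Tucker conditions for linear constraints, with linearly independent support. -/
theorem exists_multipliers_of_isMinOn {φ : E → ℝ} {p y : E} (a : ι → E) (c : ι → ℝ)
    (hφ : HasGradientAt φ p y) (hy : ∀ i, inner ℝ (a i) y ≤ c i)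
    (hmin : IsMinOn φ {z | ∀ i, inner ℝ (a i) z ≤ c i} y) :
    ∃ T : Finset ι, ∃ l : ι → ℝ, LinearIndepOn ℝ a (T : Set ι) ∧ (∀ i, 0 ≤ l i) ∧
      (∀ i ∉ T, l i = 0) ∧ (∀ i ∈ T, inner ℝ (a i) y = c i) ∧ p + ∑ i, l i • a i = 0 := by
  classical
  have hdual : ∀ d : E, (∀ i ∈ Finset.univ.filter fun i => inner ℝ (a i) y = c i,
      inner ℝ (a i) d ≤ 0) → inner ℝ (-p) d ≤ 0 := by
    intro d hd
    -- For small `t > 0` the point `y + t d` is feasible: slack constraints stay slack, and active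
    -- ones do not increase along `d`.
    have hcone : d ∈ posTangentConeAt {z | ∀ i, inner ℝ (a i) z ≤ c i} y := by
      refine mem_posTangentConeAt_of_frequently_mem (Eventually.frequently ?_)
      simp only [mem_ofPred_eq]
      refine eventually_all.2 fun i => ?_
      rcases (hy i).lt_or_eq with h | h
      · have hcont : ContinuousAt (fun t : ℝ => (inner ℝ (a i) (y + t • d) : ℝ)) 0 := by fun_prop
        have := hcont.eventually_lt_const (by simpa using h : _ < c i)
        filter_upwards [nhdsWithin_le_nhds this] with t ht using ht.le
      · filter_upwards [self_mem_nhdsWithin] with t ht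
        rw [inner_add_right, inner_smul_right, h]
        have := mul_nonpos_of_nonneg_of_nonpos (le_of_lt (mem_Ioi.1 ht)) (hd i (by simp [h]))
        linarith
    have := hmin.localize.hasFDerivWithinAt_nonneg hφ.hasFDerivAt.hasFDerivWithinAt hcone
    rw [InnerProductSpace.toDual_apply_apply] at this
    rw [inner_neg_left]
    linarith
  obtain ⟨T, hT, l, h1, h2, h3, h4⟩ := farkas a
    (Finset.univ.filter fun i => inner ℝ (a i) y = c i) (-p) hdual
  refine ⟨T, l, h1, h2, h3, fun i hi => ?_, by rw [← h4, add_neg_cancel]⟩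
  simpa using hT hi

end Inner

end Cones

/-! ### Strong convexity and a piecewise mean value inequality. -/

section Calculus

variable {E : Type*} [NormedAddCommGroup E]

/-- First order characterization of strong convexity. -/
theorem StrongConvexOn.add_le_of_hasGradientAt [InnerProductSpace ℝ E] [CompleteSpace E]
    {φ : E → ℝ} {μ : ℝ}
    (hφ : StrongConvexOn univ μ φ) {p y : E} (hp : HasGradientAt φ p y) (z : E) :
    φ y + inner ℝ p (z - y) + μ / 2 * ‖z - y‖ ^ 2 ≤ φ z := by
  have hline : HasDerivAt (fun t : ℝ => φ (y + t • (z - y))) (inner ℝ p (z - y)) 0 := by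
    have h1 : HasDerivAt (fun t : ℝ => y + t • (z - y)) (z - y) 0 := by
      simpa using ((hasDerivAt_id (0 : ℝ)).smul_const (z - y)).const_add y
    have h2 : HasFDerivAt φ (InnerProductSpace.toDual ℝ E p) (y + (0 : ℝ) • (z - y)) := by
      simpa using hp.hasFDerivAt
    have := h2.comp_hasDerivAt (0 : ℝ) h1
    rwa [InnerProductSpace.toDual_apply_apply] at this
  have hslope := (hasDerivAt_iff_tendsto_slope.1 hline).mono_left (nhdsGT_le_nhdsNE 0)
  -- The convexity inequality divided by `t` bounds the slope by this expression for `0 < t < 1`.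
  have hlim : Tendsto (fun t : ℝ => φ z - φ y - (1 - t) * (μ / 2 * ‖z - y‖ ^ 2)) (𝓝[>] 0)
      (𝓝 (φ z - φ y - (1 - 0) * (μ / 2 * ‖z - y‖ ^ 2))) := by
    refine (Continuous.tendsto ?_ 0).mono_left nhdsWithin_le_nhds
    fun_prop
  have := le_of_tendsto_of_tendsto hslope hlim ?_
  · linarith
  filter_upwards [Ioo_mem_nhdsGT (zero_lt_one (α := ℝ))] with t ht
  have h := hφ.2 (mem_univ y) (mem_univ z) (sub_nonneg.2 ht.2.le) ht.1.le (by ring)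
  have hpt : (1 - t) • y + t • z = y + t • (z - y) := by module
  rw [hpt, norm_sub_rev y z] at h
  simp only [smul_eq_mul] at h
  rw [slope_def_field, sub_zero, zero_smul, add_zero, div_le_iff₀ ht.1]
  linarith

/-- Add the first order inequalities at the two points; each contributes `μ / 2`. -/
theorem StrongConvexOn.le_inner_sub_of_hasGradientAt [InnerProductSpace ℝ E] [CompleteSpace E]
    {φ : E → ℝ} {μ : ℝ}
    (hφ : StrongConvexOn univ μ φ) {p q y z : E} (hp : HasGradientAt φ p y)
    (hq : HasGradientAt φ q z) : μ * ‖y - z‖ ^ 2 ≤ inner ℝ (p - q) (y - z) := by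
  have h1 := StrongConvexOn.add_le_of_hasGradientAt hφ hp z
  have h2 := StrongConvexOn.add_le_of_hasGradientAt hφ hq y
  rw [norm_sub_rev z y] at h1
  rw [← neg_sub y z, inner_neg_right] at h1
  rw [inner_sub_left]
  linarith

/-- A continuous curve on `[0, 1]` which is `C`-Lipschitz on each set of a finite cover satisfies
`‖f 1 - f 0‖ ≤ C`. -/
theorem norm_sub_le_of_finite_cover {J : Type*} [Finite J] {f : ℝ → E} {C : ℝ}
    (hf : ContinuousOn f (Icc 0 1)) (T : J → Set ℝ) (hT : Icc 0 1 ⊆ ⋃ j, T j)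
    (hlip : ∀ j, ∀ s ∈ T j ∩ Icc 0 1, ∀ t ∈ T j ∩ Icc 0 1, ‖f s - f t‖ ≤ C * |s - t|) :
    ‖f 1 - f 0‖ ≤ C := by
  have main : ∀ ⦃x⦄, x ∈ Icc (0 : ℝ) 1 → ‖f x - f 0‖ ≤ C * x := by
    refine image_le_of_liminf_slope_right_le_deriv_boundary (f := fun t => ‖f t - f 0‖)
      (B := fun t => C * t) (B' := fun _ => C)
      (hf.sub continuousOn_const).norm (by simp) (by fun_prop)
      (fun x _ => by simpa using ((hasDerivAt_id x).const_mul C).hasDerivWithinAt) ?_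
    intro t ht r hr
    have hmem : ∀ᶠ z in 𝓝[>] t, z ∈ Icc (0 : ℝ) 1 :=
      mem_of_superset (Ioo_mem_nhdsGT ht.2) fun z hz => ⟨ht.1.trans hz.1.le, hz.2.le⟩
    -- Finitely many pieces, so one of them accumulates at `t` from the right.
    obtain ⟨j, hj⟩ : ∃ j, ∃ᶠ z in 𝓝[>] t, z ∈ T j := by
      by_contra! hcon
      have : ∀ᶠ z in 𝓝[>] t, ∀ j, z ∉ T j := eventually_all.2 fun j => by
        simpa [Filter.Frequently] using hcon j
      obtain ⟨z, hz1, hz2⟩ := (this.and hmem).exists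
      obtain ⟨j, hj⟩ := mem_iUnion.1 (hT hz2)
      exact hz1 j hj
    have htc : ContinuousWithinAt f (Icc 0 1) t := hf t (Ico_subset_Icc_self ht)
    refine (hj.and_eventually (hmem.and self_mem_nhdsWithin)).mono ?_
    rintro z ⟨hzj, hz, hzt : t < z⟩
    -- The point `t` itself need not lie in `T j`; the bound is obtained by letting `w → t` inside
    -- `T j`, using continuity of `f`.
    have hle : ‖f z - f t‖ ≤ C * |z - t| := by
      have hfr : (𝓝[>] t ⊓ 𝓟 (T j)).NeBot := frequently_iff_neBot.1 hj
      have hle' : 𝓝[>] t ⊓ 𝓟 (T j) ≤ 𝓝[Icc 0 1] t := by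
        refine le_inf (inf_le_left.trans nhdsWithin_le_nhds) ?_
        exact inf_le_left.trans (le_principal_iff.2 hmem)
      have l1 : Tendsto (fun w => ‖f z - f w‖) (𝓝[>] t ⊓ 𝓟 (T j)) (𝓝 ‖f z - f t‖) :=
        (tendsto_const_nhds.sub (htc.mono_left hle')).norm
      have l2 : Tendsto (fun w => C * |z - w|) (𝓝[>] t ⊓ 𝓟 (T j)) (𝓝 (C * |z - t|)) := by
        refine (Continuous.tendsto (by fun_prop) t).mono_left (inf_le_left.trans
          nhdsWithin_le_nhds)
      refine le_of_tendsto_of_tendsto l1 l2 ?_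
      filter_upwards [mem_inf_of_right (mem_principal_self (T j)),
        mem_inf_of_left hmem] with w hw1 hw2
      exact hlip j z ⟨hzj, hz⟩ w ⟨hw1, hw2⟩
    refine lt_of_le_of_lt ?_ hr
    rw [slope_def_field, div_le_iff₀ (sub_pos.2 hzt)]
    rw [abs_of_pos (sub_pos.2 hzt)] at hle
    have := norm_sub_norm_le (f z - f 0) (f t - f 0)
    rw [sub_sub_sub_cancel_right] at this
    exact this.trans hle
  simpa using main (right_mem_Icc.2 zero_le_one)

end Calculus

/-- A quadratic inequality with linear consequence. -/
theorem le_mul_of_sq_le_mul_add {μ A r δ : ℝ} (hμ : 0 < μ) (hA : 0 ≤ A)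
    (hδ : 0 ≤ δ) (h : μ * r ^ 2 ≤ A * δ * r + A * δ ^ 2) : r ≤ (1 + 2 * A / μ) * δ := by
  rcases le_or_gt r δ with hle | hlt
  · refine hle.trans (le_mul_of_one_le_left hδ ?_)
    exact le_add_of_nonneg_right (by positivity)
  · have hrpos : 0 < r := hδ.trans_lt hlt
    have h2 : μ * r ≤ 2 * A * δ := by
      refine le_of_mul_le_mul_right ?_ hrpos
      have : A * δ ^ 2 ≤ A * δ * r := by
        rw [sq, ← mul_assoc]
        gcongr
      linarith
    have h3 : r ≤ 2 * A / μ * δ := by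
      rw [div_mul_eq_mul_div, le_div_iff₀ hμ]
      linarith
    linarith

/-! ### Partial gradients and the total derivative. -/

section PartialGradients

variable {du dl : ℕ}
  {f : EuclideanSpace ℝ (Fin du) → EuclideanSpace ℝ (Fin dl) → ℝ}

theorem hasFDerivAt_partial_left (hf : ContDiff ℝ 1 (Function.uncurry f))
    (x : EuclideanSpace ℝ (Fin du)) (y : EuclideanSpace ℝ (Fin dl)) :
    HasFDerivAt (fun x' => f x' y)
      ((fderiv ℝ (Function.uncurry f) (x, y)).comp (ContinuousLinearMap.inl ℝ _ _)) x :=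
  ((hf.differentiable one_ne_zero) (x, y)).hasFDerivAt.comp (f := fun x' => (x', y)) x
    (hasFDerivAt_prodMk_left x y)

theorem hasFDerivAt_partial_right (hf : ContDiff ℝ 1 (Function.uncurry f))
    (x : EuclideanSpace ℝ (Fin du)) (y : EuclideanSpace ℝ (Fin dl)) :
    HasFDerivAt (fun y' => f x y')
      ((fderiv ℝ (Function.uncurry f) (x, y)).comp (ContinuousLinearMap.inr ℝ _ _)) y :=
  ((hf.differentiable one_ne_zero) (x, y)).hasFDerivAt.comp (f := fun y' => (x, y')) y
    (hasFDerivAt_prodMk_right x y)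

theorem hasGradientAt_gradX (hf : ContDiff ℝ 1 (Function.uncurry f))
    (x : EuclideanSpace ℝ (Fin du)) (y : EuclideanSpace ℝ (Fin dl)) :
    HasGradientAt (fun x' => f x' y) (gradX f x y) x :=
  (hasFDerivAt_partial_left hf x y).differentiableAt.hasGradientAt

theorem hasGradientAt_gradY (hf : ContDiff ℝ 1 (Function.uncurry f))
    (x : EuclideanSpace ℝ (Fin du)) (y : EuclideanSpace ℝ (Fin dl)) :
    HasGradientAt (f x) (gradY f x y) y :=
  (hasFDerivAt_partial_right hf x y).differentiableAt.hasGradientAt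

theorem fderiv_uncurry_apply (hf : ContDiff ℝ 1 (Function.uncurry f))
    (x u : EuclideanSpace ℝ (Fin du)) (y v : EuclideanSpace ℝ (Fin dl)) :
    fderiv ℝ (Function.uncurry f) (x, y) (u, v) =
      inner ℝ (gradX f x y) u + inner ℝ (gradY f x y) v := by
  have h1 := (hasFDerivAt_partial_left hf x y).unique (hasGradientAt_gradX hf x y).hasFDerivAt
  have h2 := (hasFDerivAt_partial_right hf x y).unique (hasGradientAt_gradY hf x y).hasFDerivAt
  have e1 := DFunLike.congr_fun h1 u
  have e2 := DFunLike.congr_fun h2 v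
  simp only [ContinuousLinearMap.comp_apply, ContinuousLinearMap.inl_apply,
    ContinuousLinearMap.inr_apply, InnerProductSpace.toDual_apply_apply] at e1 e2
  rw [← e1, ← e2, ← map_add]
  simp

theorem contDiff_gradY (hf : ContDiff ℝ 2 (Function.uncurry f)) :
    ContDiff ℝ 1 (Function.uncurry (gradY f)) := by
  have hf1 : ContDiff ℝ 1 (Function.uncurry f) := hf.of_le (by norm_num)
  have h : Function.uncurry (gradY f) = fun p =>
      (InnerProductSpace.toDual ℝ (EuclideanSpace ℝ (Fin dl))).symm
        ((fderiv ℝ (Function.uncurry f) p).comp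
          (ContinuousLinearMap.inr ℝ (EuclideanSpace ℝ (Fin du)) (EuclideanSpace ℝ (Fin dl)))) := by
    funext ⟨x, y⟩
    rw [← (hasFDerivAt_partial_right hf1 x y).fderiv]
    rfl
  rw [h]
  have h' : ContDiff ℝ 1 (fun p => (fderiv ℝ (Function.uncurry f) p).comp
      (ContinuousLinearMap.inr ℝ (EuclideanSpace ℝ (Fin du)) (EuclideanSpace ℝ (Fin dl)))) :=
    (hf.fderiv_right (by norm_num)).clm_comp contDiff_const
  exact (InnerProductSpace.toDual ℝ (EuclideanSpace ℝ (Fin dl))).symm.contDiff.comp h'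

end PartialGradients

/-! ### KKT conditions, energy estimate and uniform Lipschitz continuity. -/

namespace LowerLevel

variable {du dl k : ℕ} (P : LowerLevel du dl k)

/-- The `i`-th row of `A` as a vector. -/
def rowA (i : Fin k) : EuclideanSpace ℝ (Fin dl) := WithLp.toLp 2 (P.A i)

/-- The `i`-th row of `B` as a vector. -/
def rowB (i : Fin k) : EuclideanSpace ℝ (Fin du) := WithLp.toLp 2 (P.B i)

theorem A_mulVec (y : EuclideanSpace ℝ (Fin dl)) (i : Fin k) :
    (P.A *ᵥ y.ofLp) i = inner ℝ (P.rowA i) y := by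
  simp [rowA, Matrix.mulVec, dotProduct, PiLp.inner_apply, mul_comm]

theorem B_mulVec (x : EuclideanSpace ℝ (Fin du)) (i : Fin k) :
    (P.B *ᵥ x.ofLp) i = inner ℝ (P.rowB i) x := by
  simp [rowB, Matrix.mulVec, dotProduct, PiLp.inner_apply, mul_comm]

theorem toLp_A_transpose_mulVec (l : Fin k → ℝ) :
    WithLp.toLp 2 (P.Aᵀ *ᵥ l) = ∑ i, l i • P.rowA i := by
  ext j
  simp [rowA, Matrix.mulVec, dotProduct, mul_comm]

theorem mem_feasible {x : EuclideanSpace ℝ (Fin du)} {y : EuclideanSpace ℝ (Fin dl)} :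
    y ∈ P.feasible x ↔ ∀ i, inner ℝ (P.rowA i) y + inner ℝ (P.rowB i) x ≤ P.b i := by
  simp only [feasible, mem_ofPred_eq, A_mulVec, B_mulVec]

theorem mem_active {x : EuclideanSpace ℝ (Fin du)} {y : EuclideanSpace ℝ (Fin dl)} {i : Fin k} :
    i ∈ P.active x y ↔ inner ℝ (P.rowA i) y + inner ℝ (P.rowB i) x = P.b i := by
  simp only [active, Finset.mem_filter, Finset.mem_univ, true_and, A_mulVec, B_mulVec]

theorem feasible_eq (x : EuclideanSpace ℝ (Fin du)) :
    P.feasible x = {y | ∀ i, inner ℝ (P.rowA i) y ≤ P.b i - inner ℝ (P.rowB i) x} := by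
  ext y
  simp only [mem_feasible, mem_ofPred_eq, le_sub_iff_add_le]

/-- The standing assumptions on the lower-level problem: smoothness, compactness of the feasible
sets, strong convexity and strict feasibility. -/
structure Regular (μ : ℝ) : Prop where
  contDiff : ContDiff ℝ 2 (Function.uncurry P.g)
  isCompact_feasible : ∀ x, IsCompact (P.feasible x)
  pos : 0 < μ
  strongConvexOn : ∀ x, StrongConvexOn Set.univ μ (P.g x)
  exists_strict : ∀ x : EuclideanSpace ℝ (Fin du), ∃ y : EuclideanSpace ℝ (Fin dl),
    ∀ i, (P.A *ᵥ y.ofLp) i + (P.B *ᵥ x.ofLp) i < P.b i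

namespace Regular

variable {P} {μ : ℝ}

theorem hasGradientAt (hP : P.Regular μ)
    (x : EuclideanSpace ℝ (Fin du)) (y : EuclideanSpace ℝ (Fin dl)) :
    HasGradientAt (P.g x) (gradY P.g x y) y :=
  hasGradientAt_gradY (hP.contDiff.of_le (by norm_num)) x y

theorem hasGradientAt_perturbed (hP : P.Regular μ)
    (q : EuclideanSpace ℝ (Fin dl)) (x : EuclideanSpace ℝ (Fin du))
    (y : EuclideanSpace ℝ (Fin dl)) :
    HasGradientAt (P.perturbed q x) (gradY P.g x y + q) y := by
  have h1 := (hP.hasGradientAt x y).hasFDerivAt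
  have h2 : HasFDerivAt (fun y' => inner ℝ q y') (InnerProductSpace.toDual ℝ _ q) y :=
    (InnerProductSpace.toDual ℝ (EuclideanSpace ℝ (Fin dl)) q).hasFDerivAt
  rw [hasGradientAt_iff_hasFDerivAt, map_add]
  exact h1.add h2

theorem gradY_perturbed (hP : P.Regular μ)
    (q : EuclideanSpace ℝ (Fin dl)) (x : EuclideanSpace ℝ (Fin du))
    (y : EuclideanSpace ℝ (Fin dl)) :
    gradY (P.perturbed q) x y = gradY P.g x y + q :=
  (hP.hasGradientAt_perturbed q x y).gradient

theorem isMultiplier_iff (hP : P.Regular μ)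
    {q : EuclideanSpace ℝ (Fin dl)} {x : EuclideanSpace ℝ (Fin du)}
    {y : EuclideanSpace ℝ (Fin dl)} {l : Fin k → ℝ} :
    P.IsMultiplier q x y l ↔ gradY P.g x y + q + ∑ i, l i • P.rowA i = 0 ∧
      (∀ i, l i * (inner ℝ (P.rowA i) y + inner ℝ (P.rowB i) x - P.b i) = 0) ∧
      (∀ i, 0 ≤ l i) ∧ y ∈ P.feasible x := by
  rw [IsMultiplier, hP.gradY_perturbed, ← P.toLp_A_transpose_mulVec]
  simp only [A_mulVec, B_mulVec]
  refine and_congr_left fun _ => ?_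
  rw [← (WithLp.ofLp_injective 2).eq_iff]
  rfl

theorem exists_isSolution (hP : P.Regular μ)
    (q : EuclideanSpace ℝ (Fin dl)) (x : EuclideanSpace ℝ (Fin du)) :
    ∃ y, P.IsSolution q x y := by
  obtain ⟨y₀, hy₀⟩ := hP.exists_strict x
  have hc : Continuous (P.perturbed q x) := continuous_iff_continuousAt.2 fun y =>
    (hP.hasGradientAt_perturbed q x y).continuousAt
  obtain ⟨y, hy, hmin⟩ := (hP.isCompact_feasible x).exists_isMinOn ⟨y₀, fun i => (hy₀ i).le⟩
    hc.continuousOn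
  exact ⟨y, hy, hmin⟩

theorem isSolution_ystar (hP : P.Regular μ)
    (q : EuclideanSpace ℝ (Fin dl)) (x : EuclideanSpace ℝ (Fin du)) :
    P.IsSolution q x (P.ystar q x) :=
  Classical.epsilon_spec (hP.exists_isSolution q x)

theorem ystar_mem (hP : P.Regular μ)
    (q : EuclideanSpace ℝ (Fin dl)) (x : EuclideanSpace ℝ (Fin du)) :
    P.ystar q x ∈ P.feasible x :=
  (hP.isSolution_ystar q x).1

/-- Multipliers with linearly independent support exist. -/
theorem exists_isMultiplier (hP : P.Regular μ)
    (q : EuclideanSpace ℝ (Fin dl)) (x : EuclideanSpace ℝ (Fin du)) :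
    ∃ T : Finset (Fin k), ∃ l, LinearIndepOn ℝ P.rowA (T : Set (Fin k)) ∧ (∀ i ∉ T, l i = 0) ∧
      P.IsMultiplier q x (P.ystar q x) l := by
  obtain ⟨hmem, hmin⟩ := hP.isSolution_ystar q x
  rw [feasible_eq] at hmem hmin
  obtain ⟨T, l, h1, h2, h3, h4, h5⟩ := exists_multipliers_of_isMinOn P.rowA
    (fun i => P.b i - inner ℝ (P.rowB i) x) (hP.hasGradientAt_perturbed q x (P.ystar q x))
    hmem hmin
  refine ⟨T, l, h1, h3, hP.isMultiplier_iff.2 ⟨h5, fun i => ?_, h2, hP.ystar_mem q x⟩⟩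
  by_cases hi : i ∈ T
  · rw [h4 i hi]
    ring
  · rw [h3 i hi, zero_mul]

/-- The basic energy estimate comparing two solutions. -/
theorem energy_le (hP : P.Regular μ)
    {q₁ q₂ : EuclideanSpace ℝ (Fin dl)} {x₁ x₂ : EuclideanSpace ℝ (Fin du)}
    {y₁ y₂ : EuclideanSpace ℝ (Fin dl)} {l₁ l₂ : Fin k → ℝ}
    (h₁ : P.IsMultiplier q₁ x₁ y₁ l₁) (h₂ : P.IsMultiplier q₂ x₂ y₂ l₂) :
    μ * ‖y₁ - y₂‖ ^ 2 ≤ inner ℝ (gradY P.g x₂ y₂ - gradY P.g x₁ y₂) (y₁ - y₂) +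
      inner ℝ (q₂ - q₁) (y₁ - y₂) + ∑ i, (l₁ i - l₂ i) * inner ℝ (P.rowB i) (x₁ - x₂) := by
  obtain ⟨e1, c1, n1, f1⟩ := hP.isMultiplier_iff.1 h₁
  obtain ⟨e2, c2, n2, f2⟩ := hP.isMultiplier_iff.1 h₂
  rw [mem_feasible] at f1 f2
  have hm := StrongConvexOn.le_inner_sub_of_hasGradientAt (hP.strongConvexOn x₁)
    (hP.hasGradientAt x₁ y₁) (hP.hasGradientAt x₁ y₂)
  have hG : gradY P.g x₁ y₁ - gradY P.g x₁ y₂ = (gradY P.g x₂ y₂ - gradY P.g x₁ y₂) +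
      (q₂ - q₁) + ∑ i, (l₂ i - l₁ i) • P.rowA i := by
    simp only [sub_smul, Finset.sum_sub_distrib]
    rw [← sub_eq_zero, ← sub_eq_zero.2 (e1.trans e2.symm)]
    abel
  rw [hG, inner_add_left, inner_add_left, sum_inner] at hm
  refine hm.trans ?_
  -- With residuals `s₁, s₂ ≤ 0` of constraint `i`, complementarity reduces the claim to `l₂ s₁ + l₁
  -- s₂ ≤ 0`.
  gcongr with i
  rw [inner_smul_left, inner_sub_right, inner_sub_right]
  simp only [conj_trivial]
  have := mul_nonneg (n2 i) (sub_nonneg.2 (f1 i))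
  have := mul_nonneg (n1 i) (sub_nonneg.2 (f2 i))
  have := c1 i
  have := c2 i
  nlinarith

theorem norm_ystar_sub_le (hP : P.Regular μ)
    (q₁ q₂ : EuclideanSpace ℝ (Fin dl)) (x : EuclideanSpace ℝ (Fin du)) :
    ‖P.ystar q₁ x - P.ystar q₂ x‖ ≤ μ⁻¹ * ‖q₁ - q₂‖ := by
  obtain ⟨-, l₁, -, -, h₁⟩ := hP.exists_isMultiplier q₁ x
  obtain ⟨-, l₂, -, -, h₂⟩ := hP.exists_isMultiplier q₂ x
  have h := hP.energy_le h₁ h₂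
  simp only [sub_self, inner_zero_left, inner_zero_right, mul_zero, Finset.sum_const_zero,
    zero_add, add_zero] at h
  have h' := h.trans (real_inner_le_norm _ _)
  rw [norm_sub_rev q₂ q₁] at h'
  rw [inv_mul_eq_div, le_div_iff₀ hP.pos]
  rcases (norm_nonneg (P.ystar q₁ x - P.ystar q₂ x)).eq_or_lt with h0 | h0
  · rw [← h0, zero_mul]
    positivity
  · refine le_of_mul_le_mul_right ?_ h0
    linarith

/-- Otherwise `d` would be a recession direction of a nonempty compact feasible set. The condition
does not involve `x`, which is what makes bounds uniform in `x` possible. -/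
theorem exists_inner_rowA_pos (hP : P.Regular μ) {d : EuclideanSpace ℝ (Fin dl)} (hd : d ≠ 0) :
    ∃ i, 0 < inner ℝ (P.rowA i) d := by
  by_contra! h
  obtain ⟨y₀, hy₀⟩ := hP.exists_strict 0
  obtain ⟨C, hC⟩ := (hP.isCompact_feasible 0).isBounded.exists_norm_le
  have hmem : ∀ t : ℝ, 0 ≤ t → y₀ + t • d ∈ P.feasible 0 := by
    intro t ht
    refine P.mem_feasible.2 fun i => ?_
    have h1 := hy₀ i
    rw [A_mulVec, B_mulVec] at h1
    have h2 := mul_nonpos_of_nonneg_of_nonpos ht (h i)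
    rw [inner_add_right, inner_smul_right]
    linarith
  have hd0 : 0 < ‖d‖ := norm_pos_iff.2 hd
  have hC0 : 0 ≤ C := (norm_nonneg _).trans (hC _ (hmem 0 le_rfl))
  set t : ℝ := (C + ‖y₀‖ + 1) / ‖d‖ with ht
  have ht0 : 0 ≤ t := by positivity
  have h1 := hC _ (hmem t ht0)
  have h2 : ‖t • d‖ = C + ‖y₀‖ + 1 := by
    rw [norm_smul, Real.norm_of_nonneg ht0, ht, div_mul_cancel₀ _ hd0.ne']
  have h3 : ‖t • d‖ ≤ ‖y₀ + t • d‖ + ‖y₀‖ := by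
    simpa [add_comm] using norm_sub_le (y₀ + t • d) y₀
  linarith

/-- The feasible sets over a ball are uniformly bounded. -/
theorem exists_feasible_subset_closedBall (hP : P.Regular μ) (R : ℝ) :
    ∃ ρ : ℝ, ∀ x ∈ Metric.closedBall (0 : EuclideanSpace ℝ (Fin du)) R,
      P.feasible x ⊆ Metric.closedBall 0 ρ := by
  -- Positively homogeneous and positive on the unit sphere, hence at least `ε ‖y‖`; on feasible
  -- points it is bounded through `b` and `B x`.
  set φ : EuclideanSpace ℝ (Fin dl) → ℝ := fun d => ∑ i, max 0 (inner ℝ (P.rowA i) d) with hφ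
  have hφc : Continuous φ := by fun_prop
  obtain ⟨ε, hε, hεφ⟩ := (isCompact_sphere (0 : EuclideanSpace ℝ (Fin dl)) 1).exists_forall_le'
    (a := 0) hφc.continuousOn fun d hd => by
      have hd0 : d ≠ 0 := by
        rintro rfl
        simp at hd
      obtain ⟨i, hi⟩ := hP.exists_inner_rowA_pos hd0
      exact Finset.sum_pos' (fun j _ => le_max_left _ _)
        ⟨i, Finset.mem_univ i, lt_max_of_lt_right hi⟩
  have hlow : ∀ y, ε * ‖y‖ ≤ φ y := by
    intro y
    rcases eq_or_ne y 0 with rfl | hy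
    · simp [hφ]
    have hy0 : 0 < ‖y‖ := norm_pos_iff.2 hy
    have h := hεφ (‖y‖⁻¹ • y) (by simp [norm_smul, hy0.ne'])
    have h2 : φ (‖y‖⁻¹ • y) = ‖y‖⁻¹ * φ y := by
      simp only [hφ, Finset.mul_sum]
      refine Finset.sum_congr rfl fun i _ => ?_
      rw [inner_smul_right, mul_max_of_nonneg _ _ (by positivity), mul_zero]
    rwa [h2, inv_mul_eq_div, le_div_iff₀ hy0] at h
  refine ⟨(∑ i, (|P.b i| + ‖P.rowB i‖ * R)) / ε, fun x hx y hy => ?_⟩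
  rw [mem_closedBall_zero_iff] at hx ⊢
  rw [le_div_iff₀ hε, mul_comm]
  refine (hlow y).trans (Finset.sum_le_sum fun i _ => ?_)
  have h1 := P.mem_feasible.1 hy i
  have h2 := neg_le_of_abs_le (abs_real_inner_le_norm (P.rowB i) x)
  have h3 : ‖P.rowB i‖ * ‖x‖ ≤ ‖P.rowB i‖ * R := by gcongr
  have h4 := le_abs_self (P.b i)
  have hR : 0 ≤ R := (norm_nonneg x).trans hx
  exact max_le (by positivity) (by linarith)

set_option maxHeartbeats 400000 in
/-- On every ball the solution map `y_q*` is Lipschitz, uniformly in `q`. -/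
theorem exists_lipschitz_ystar (hP : P.Regular μ)
    (R : ℝ) : ∃ C : ℝ, 0 ≤ C ∧ ∀ q : EuclideanSpace ℝ (Fin dl),
    ∀ x₁ ∈ Metric.closedBall (0 : EuclideanSpace ℝ (Fin du)) R,
    ∀ x₂ ∈ Metric.closedBall (0 : EuclideanSpace ℝ (Fin du)) R,
      ‖P.ystar q x₁ - P.ystar q x₂‖ ≤ C * ‖x₁ - x₂‖ := by
  obtain ⟨ρ, hρ⟩ := hP.exists_feasible_subset_closedBall R
  obtain ⟨K, hK0, hK⟩ := exists_norm_le_norm_sum_smul P.rowA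
  set D := Metric.closedBall (0 : EuclideanSpace ℝ (Fin du)) R ×ˢ
    Metric.closedBall (0 : EuclideanSpace ℝ (Fin dl)) ρ with hD
  have hDc : IsCompact D := (isCompact_closedBall _ _).prod (isCompact_closedBall _ _)
  have hG := contDiff_gradY hP.contDiff
  obtain ⟨L, hL⟩ := hG.contDiffOn.exists_lipschitzOnWith (s := D) one_ne_zero
    ((convex_closedBall _ _).prod (convex_closedBall _ _)) hDc
  have hLG : ∀ x₁ ∈ Metric.closedBall (0 : EuclideanSpace ℝ (Fin du)) R,
      ∀ x₂ ∈ Metric.closedBall (0 : EuclideanSpace ℝ (Fin du)) R,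
      ∀ y₁ ∈ P.feasible x₁, ∀ y₂ ∈ P.feasible x₂,
      ‖gradY P.g x₁ y₁ - gradY P.g x₂ y₂‖ ≤ L * (‖x₁ - x₂‖ + ‖y₁ - y₂‖) := by
    intro x₁ hx₁ x₂ hx₂ y₁ hy₁ y₂ hy₂
    have := hL.norm_sub_le (x := (x₁, y₁)) (y := (x₂, y₂)) ⟨hx₁, hρ _ hx₁ hy₁⟩
      ⟨hx₂, hρ _ hx₂ hy₂⟩
    refine this.trans ?_
    gcongr
    rw [Prod.mk_sub_mk, Prod.norm_mk]
    exact max_le_add_of_nonneg (norm_nonneg _) (norm_nonneg _)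
  obtain ⟨Γ, hΓ⟩ := (hDc.image hG.continuous).isBounded.exists_norm_le
  set β := ∑ i, ‖P.rowB i‖ with hβ
  have hβ0 : 0 ≤ β := Finset.sum_nonneg fun i _ => norm_nonneg _
  have hsum : ∀ (l : Fin k → ℝ) (x : EuclideanSpace ℝ (Fin du)),
      ∑ i, l i * inner ℝ (P.rowB i) x ≤ ‖l‖ * (β * ‖x‖) := by
    intro l x
    rw [hβ, Finset.sum_mul, Finset.mul_sum]
    refine Finset.sum_le_sum fun i _ => (le_abs_self _).trans ?_
    rw [abs_mul]
    exact mul_le_mul (norm_le_pi_norm l i) (abs_real_inner_le_norm _ _) (abs_nonneg _)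
      (norm_nonneg _)
  choose T l hT hlT hl using fun (q : EuclideanSpace ℝ (Fin dl)) x => hP.exists_isMultiplier q x
  have henergy : ∀ q, ∀ x₁ ∈ Metric.closedBall (0 : EuclideanSpace ℝ (Fin du)) R,
      ∀ x₂ ∈ Metric.closedBall (0 : EuclideanSpace ℝ (Fin du)) R,
      μ * ‖P.ystar q x₁ - P.ystar q x₂‖ ^ 2 ≤
        L * ‖x₁ - x₂‖ * ‖P.ystar q x₁ - P.ystar q x₂‖ +
        ‖l q x₁ - l q x₂‖ * (β * ‖x₁ - x₂‖) := by
    intro q x₁ hx₁ x₂ hx₂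
    have h := hP.energy_le (hl q x₁) (hl q x₂)
    rw [sub_self, inner_zero_left, add_zero] at h
    refine h.trans (add_le_add ((real_inner_le_norm _ _).trans ?_) (hsum (l q x₁ - l q x₂) _))
    gcongr
    have := hL.norm_sub_le (x := (x₂, P.ystar q x₂)) (y := (x₁, P.ystar q x₂))
      ⟨hx₂, hρ _ hx₂ (hP.ystar_mem q x₂)⟩ ⟨hx₁, hρ _ hx₂ (hP.ystar_mem q x₂)⟩
    rw [Prod.mk_sub_mk, Prod.norm_mk, sub_self, norm_zero, max_eq_left (norm_nonneg _),
      norm_sub_rev x₂] at this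
    exact this
  -- continuity along the ball
  have hcont : ∀ q, ContinuousOn (P.ystar q) (Metric.closedBall 0 R) := by
    intro q
    have hlb : ∀ x ∈ Metric.closedBall (0 : EuclideanSpace ℝ (Fin du)) R,
        ‖l q x‖ ≤ K * (Γ + ‖q‖) := by
      intro x hx
      refine (hK _ (hT q x) _ (hlT q x)).trans ?_
      gcongr
      have h1 := (hP.isMultiplier_iff.1 (hl q x)).1
      rw [← eq_neg_iff_add_eq_zero] at h1
      rw [← norm_neg, ← h1]
      refine (norm_add_le _ _).trans ?_
      gcongr
      exact hΓ _ ⟨(x, P.ystar q x), ⟨hx, hρ _ hx (hP.ystar_mem q x)⟩, rfl⟩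
    -- Crude bounds in the energy estimate give a Hölder-1/2 estimate. Its constant depends on `q`,
    -- which is harmless since only continuity is extracted.
    set c : ℝ := (L * (2 * ρ) + (K * (Γ + ‖q‖) + K * (Γ + ‖q‖)) * β) / μ with hc
    intro x hx
    have hbound : ∀ x' ∈ Metric.closedBall (0 : EuclideanSpace ℝ (Fin du)) R,
        ‖P.ystar q x' - P.ystar q x‖ ^ 2 ≤ c * ‖x' - x‖ := by
      intro x' hx'
      rw [hc, div_mul_eq_mul_div, le_div_iff₀ hP.pos, mul_comm]
      refine (henergy q x' hx' x hx).trans ?_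
      have h1 : ‖P.ystar q x' - P.ystar q x‖ ≤ 2 * ρ := by
        have a1 := mem_closedBall_zero_iff.1 (hρ _ hx' (hP.ystar_mem q x'))
        have a2 := mem_closedBall_zero_iff.1 (hρ _ hx (hP.ystar_mem q x))
        linarith [norm_sub_le (P.ystar q x') (P.ystar q x)]
      have h2 : ‖l q x' - l q x‖ ≤ K * (Γ + ‖q‖) + K * (Γ + ‖q‖) :=
        (norm_sub_le _ _).trans (add_le_add (hlb x' hx') (hlb x hx))
      calc _ ≤ L * ‖x' - x‖ * (2 * ρ) +
            (K * (Γ + ‖q‖) + K * (Γ + ‖q‖)) * (β * ‖x' - x‖) := by gcongr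
        _ = _ := by ring
    have hlim : Tendsto (fun x' => √(c * ‖x' - x‖)) (𝓝[Metric.closedBall 0 R] x) (𝓝 0) := by
      have : Continuous (fun x' : EuclideanSpace ℝ (Fin du) => √(c * ‖x' - x‖)) := by fun_prop
      have h := this.tendsto x
      simp only [sub_self, norm_zero, mul_zero, Real.sqrt_zero] at h
      exact h.mono_left nhdsWithin_le_nhds
    rw [ContinuousWithinAt, tendsto_iff_norm_sub_tendsto_zero]
    refine squeeze_zero' (Eventually.of_forall fun _ => norm_nonneg _) ?_ hlim
    filter_upwards [self_mem_nhdsWithin] with x' hx'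
    exact Real.le_sqrt_of_sq_le (hbound x' hx')
  -- Lipschitz estimate between points with the same support
  set A : ℝ := L + K * L * β with hA
  have hA0 : 0 ≤ A := by positivity
  set C : ℝ := 1 + 2 * A / μ with hCdef
  have hC1 : 1 ≤ C := le_add_of_nonneg_right (div_nonneg (by positivity) hP.pos.le)
  have hsame : ∀ q, ∀ x₁ ∈ Metric.closedBall (0 : EuclideanSpace ℝ (Fin du)) R,
      ∀ x₂ ∈ Metric.closedBall (0 : EuclideanSpace ℝ (Fin du)) R, T q x₁ = T q x₂ →
      ‖P.ystar q x₁ - P.ystar q x₂‖ ≤ C * ‖x₁ - x₂‖ := by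
    intro q x₁ hx₁ x₂ hx₂ hTeq
    set r := ‖P.ystar q x₁ - P.ystar q x₂‖ with hr
    set δ := ‖x₁ - x₂‖ with hδ
    have hδ0 : 0 ≤ δ := norm_nonneg _
    -- Equal supports make the difference supported on independent rows; subtracting the
    -- stationarity equations cancels `q`.
    have hl12 : ‖l q x₁ - l q x₂‖ ≤ K * (L * (δ + r)) := by
      refine (hK _ (hT q x₁) _ fun i hi => ?_).trans ?_
      · rw [Pi.sub_apply, hlT q x₁ i hi, hlT q x₂ i (hTeq ▸ hi), sub_zero]
      · gcongr
        have h1 := (hP.isMultiplier_iff.1 (hl q x₁)).1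
        have h2 := (hP.isMultiplier_iff.1 (hl q x₂)).1
        have h3 : ∑ i, (l q x₁ - l q x₂) i • P.rowA i =
            -(gradY P.g x₁ (P.ystar q x₁) - gradY P.g x₂ (P.ystar q x₂)) := by
          simp only [Pi.sub_apply, sub_smul, Finset.sum_sub_distrib]
          rw [← sub_eq_zero, ← sub_eq_zero.2 (h1.trans h2.symm)]
          abel
        rw [h3, norm_neg]
        exact hLG x₁ hx₁ x₂ hx₂ _ (hP.ystar_mem q x₁) _ (hP.ystar_mem q x₂)
    have h := henergy q x₁ hx₁ x₂ hx₂
    have h' : μ * r ^ 2 ≤ A * δ * r + A * δ ^ 2 := by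
      calc μ * r ^ 2 ≤ L * δ * r + K * (L * (δ + r)) * (β * δ) := 
          h.trans (add_le_add le_rfl (mul_le_mul_of_nonneg_right hl12 (mul_nonneg hβ0 hδ0)))
        _ = A * δ * r + K * L * β * δ ^ 2 := by
          rw [hA]
          ring
        _ ≤ _ := by
          gcongr
          rw [hA]
          exact le_add_of_nonneg_left L.2
    exact le_mul_of_sq_le_mul_add hP.pos hA0 hδ0 h'
  refine ⟨C, zero_le_one.trans hC1, fun q x₁ hx₁ x₂ hx₂ => ?_⟩
  have hseg : ∀ t ∈ Icc (0 : ℝ) 1, x₂ + t • (x₁ - x₂) ∈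
      Metric.closedBall (0 : EuclideanSpace ℝ (Fin du)) R := fun t ht =>
    (convex_closedBall _ _).add_smul_sub_mem hx₂ hx₁ ht
  -- The segment is covered by the sets of parameters sharing a support `S`.
  have := norm_sub_le_of_finite_cover (f := fun t => P.ystar q (x₂ + t • (x₁ - x₂)))
    (C := C * ‖x₁ - x₂‖) ((hcont q).comp (by fun_prop) hseg)
    (fun S : Finset (Fin k) => {t | T q (x₂ + t • (x₁ - x₂)) = S})
    (fun t _ => mem_iUnion.2 ⟨_, rfl⟩) ?_
  · simpa using this
  rintro S s ⟨hs, hs'⟩ t ⟨ht, ht'⟩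
  refine (hsame q _ (hseg s hs') _ (hseg t ht') (hs.trans ht.symm)).trans_eq ?_
  have : x₂ + s • (x₁ - x₂) - (x₂ + t • (x₁ - x₂)) = (s - t) • (x₁ - x₂) := by module
  rw [this, norm_smul, Real.norm_eq_abs]
  ring

theorem continuous_ystar (hP : P.Regular μ) : Continuous (Function.uncurry P.ystar) := by
  rw [continuous_iff_continuousAt]
  rintro ⟨q, x⟩
  obtain ⟨C, hC0, hC⟩ := hP.exists_lipschitz_ystar (‖x‖ + 1)
  have hx : ∀ᶠ p : EuclideanSpace ℝ (Fin dl) × EuclideanSpace ℝ (Fin du) in 𝓝 (q, x),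
      p.2 ∈ Metric.closedBall (0 : EuclideanSpace ℝ (Fin du)) (‖x‖ + 1) := by
    refine continuousAt_snd.eventually_mem ?_
    refine mem_of_superset (Metric.ball_mem_nhds x one_pos) fun x' hx' => ?_
    rw [mem_closedBall_zero_iff]
    rw [mem_ball_iff_norm] at hx'
    have := norm_sub_norm_le x' x
    linarith
  rw [ContinuousAt, tendsto_iff_norm_sub_tendsto_zero]
  have hlim : Tendsto (fun p : EuclideanSpace ℝ (Fin dl) × EuclideanSpace ℝ (Fin du) =>
      μ⁻¹ * ‖p.1 - q‖ + C * ‖p.2 - x‖) (𝓝 (q, x)) (𝓝 0) := by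
    have : Continuous (fun p : EuclideanSpace ℝ (Fin dl) × EuclideanSpace ℝ (Fin du) =>
      μ⁻¹ * ‖p.1 - q‖ + C * ‖p.2 - x‖) := by fun_prop
    simpa using this.tendsto (q, x)
  refine squeeze_zero' (Eventually.of_forall fun _ => norm_nonneg _) ?_ hlim
  filter_upwards [hx] with p hp
  have h1 := hP.norm_ystar_sub_le p.1 q p.2
  have h2 := hC q p.2 hp x (by simp)
  have h3 := norm_sub_le_norm_sub_add_norm_sub (P.ystar p.1 p.2) (P.ystar q p.2) (P.ystar q x)
  exact h3.trans (add_le_add h1 h2)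

end Regular

end LowerLevel

/-! ### Null sets of degenerate perturbations. -/

section NullSets

variable {E : Type*} [NormedAddCommGroup E] [InnerProductSpace ℝ E] [FiniteDimensional ℝ E]
  [MeasurableSpace E] [BorelSpace E]

theorem volume_hyperplane {v : E} (hv : v ≠ 0) (c : ℝ) :
    volume {z : E | inner ℝ v z = c} = 0 := by
  rcases eq_empty_or_nonempty {z : E | inner ℝ v z = c} with h | ⟨z₀, hz₀⟩
  · rw [h, measure_empty]
  have hmem : ∀ z, z ∈ AffineSubspace.mk' z₀ (LinearMap.ker (innerₛₗ ℝ v)) ↔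
      inner ℝ v z = c := by
    intro z
    rw [AffineSubspace.mem_mk', vsub_eq_sub, LinearMap.mem_ker, innerₛₗ_apply_apply, inner_sub_right,
      show inner ℝ v z₀ = c from hz₀, sub_eq_zero]
  have hset : {z : E | inner ℝ v z = c} =
      AffineSubspace.mk' z₀ (LinearMap.ker (innerₛₗ ℝ v)) := by
    ext z
    exact (hmem z).symm
  rw [hset]
  refine Measure.addHaar_affineSubspace _ _ fun htop => hv ?_
  have h1 := (hmem (z₀ + v)).1 (htop ▸ AffineSubspace.mem_top ℝ E _)
  rw [inner_add_right, show inner ℝ v z₀ = c from hz₀, add_eq_left] at h1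
  exact inner_self_eq_zero.1 h1

/-- The normal cone map has a null image on the part where one of the active constraints is
not used. -/
theorem volume_degenerate_eq_zero {ι : Type*} (a : ι → E) (c : ι → ℝ) {G : E → E}
    (hG : Differentiable ℝ G) (T : Set ι) {i : ι} (hi : a i ∉ Submodule.span ℝ (a '' T)) :
    volume {q : E | ∃ y w, (∀ j ∈ T, inner ℝ (a j) y = c j) ∧ inner ℝ (a i) y = c i ∧
      w ∈ Submodule.span ℝ (a '' T) ∧ q = -G y - w} = 0 := by
  set W := Submodule.span ℝ (a '' T) with hW
  by_cases hex : ∃ y₀, ∀ j ∈ T, inner ℝ (a j) y₀ = c j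
  swap
  · refine measure_mono_null (t := ∅) ?_ measure_empty
    rintro q ⟨y, w, hy, -⟩
    exact hex ⟨y, hy⟩
  obtain ⟨y₀, hy₀⟩ := hex
  -- A single `z` encodes the pair: `p z` is `y - y₀ ∈ Wᗮ` and `z - p z` is `w ∈ W`. The constraint
  -- `i` then restricts `z` to a hyperplane with normal `p (a i) ≠ 0`.
  set p := Wᗮ.starProjection with hp
  have hpa : p (a i) ≠ 0 := by
    rw [hp, Ne, Submodule.starProjection_apply_eq_zero_iff, Submodule.orthogonal_orthogonal]
    exact hi
  have hnull : volume {z : E | inner ℝ (a i) (y₀ + p z) = c i} = 0 := by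
    have : {z : E | inner ℝ (a i) (y₀ + p z) = c i} =
        {z : E | inner ℝ (p (a i)) z = c i - inner ℝ (a i) y₀} := by
      ext z
      simp only [mem_ofPred_eq]
      rw [inner_add_right, hp, Submodule.inner_starProjection_left_eq_right, eq_sub_iff_add_eq']
    rw [this]
    exact volume_hyperplane hpa _
  have hdiff : Differentiable ℝ fun z => -G (y₀ + p z) - (z - p z) := by fun_prop
  refine measure_mono_null ?_ (addHaar_image_eq_zero_of_differentiableOn_of_addHaar_eq_zero volume
    hdiff.differentiableOn hnull)
  rintro q ⟨y, w, hy, hiy, hw, rfl⟩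
  have h1 : p w = 0 := by
    rw [hp, Submodule.starProjection_apply_eq_zero_iff, Submodule.orthogonal_orthogonal]
    exact hw
  have h2 : p (y - y₀) = y - y₀ := by
    rw [hp, Submodule.starProjection_eq_self_iff, hW, Submodule.mem_orthogonal]
    intro u hu
    induction hu using Submodule.span_induction with
    | mem u hu =>
      obtain ⟨j, hj, rfl⟩ := hu
      rw [inner_sub_right, hy j hj, hy₀ j hj, sub_self]
    | zero => exact inner_zero_left _
    | add u v _ _ hu hv => rw [inner_add_left, hu, hv, add_zero]
    | smul r u _ hu => rw [inner_smul_left, hu, mul_zero]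
  have h3 : p (w + (y - y₀)) = y - y₀ := by rw [map_add, h1, h2, zero_add]
  refine ⟨w + (y - y₀), ?_, ?_⟩
  · rw [mem_ofPred_eq, h3, add_sub_cancel, hiy]
  · simp only [h3, add_sub_cancel, add_sub_cancel_right]

end NullSets

/-! ### Almost sure strict complementarity. -/

namespace LowerLevel.Regular

variable {du dl k : ℕ} {P : LowerLevel du dl k} {μ : ℝ}

/-- Strict complementarity holds for almost every perturbation under linear independence. -/
theorem ae_strict_complementarity (hP : P.Regular μ) (x : EuclideanSpace ℝ (Fin du)) :
    ∀ᵐ q, LinearIndepOn ℝ P.rowA (P.activeStar q x : Set (Fin k)) →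
      ∀ l, P.IsMultiplier q x (P.ystar q x) l → ∀ i ∈ P.activeStar q x, 0 < l i := by
  have hG : Differentiable ℝ (gradY P.g x) := by
    have h := (contDiff_gradY hP.contDiff).differentiable one_ne_zero
    exact h.comp (f := fun y => (x, y)) ((differentiable_const x).prodMk differentiable_id)
  have hnull : ∀ᵐ q : EuclideanSpace ℝ (Fin dl), ∀ (T : Finset (Fin k)) (i : Fin k),
      P.rowA i ∉ Submodule.span ℝ (P.rowA '' (T : Set (Fin k))) →
      q ∉ {q | ∃ y w, (∀ j ∈ (T : Set (Fin k)), inner ℝ (P.rowA j) y =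
        P.b j - inner ℝ (P.rowB j) x) ∧ inner ℝ (P.rowA i) y = P.b i - inner ℝ (P.rowB i) x ∧
        w ∈ Submodule.span ℝ (P.rowA '' (T : Set (Fin k))) ∧ q = -gradY P.g x y - w} := by
    refine ae_all_iff.2 fun T => ae_all_iff.2 fun i => ?_
    by_cases hi : P.rowA i ∈ Submodule.span ℝ (P.rowA '' (T : Set (Fin k)))
    · exact Eventually.of_forall fun q h => absurd hi h
    · have := volume_degenerate_eq_zero P.rowA (fun j => P.b j - inner ℝ (P.rowB j) x) hG T hi
      filter_upwards [measure_eq_zero_iff_ae_notMem.1 this] with q hq _ using hq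
  filter_upwards [hnull] with q hq hlin l hl i hi
  obtain ⟨h1, h2, h3, h4⟩ := hP.isMultiplier_iff.1 hl
  refine (h3 i).lt_of_ne' fun hli => ?_
  have hact : ∀ j ∈ P.activeStar q x,
      inner ℝ (P.rowA j) (P.ystar q x) = P.b j - inner ℝ (P.rowB j) x := fun j hj =>
    eq_sub_iff_add_eq.2 (P.mem_active.1 hj)
  -- Since `l i = 0`, the multiplier combination lies in the span of the remaining active rows.
  refine hq ((P.activeStar q x).erase i) i ?_ ⟨P.ystar q x, ∑ j, l j • P.rowA j, ?_, hact i hi,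
    ?_, ?_⟩
  · rw [Finset.coe_erase]
    exact LinearIndepOn.notMem_span hlin (Finset.mem_coe.2 hi)
  · intro j hj
    exact hact j (Finset.mem_of_mem_erase (Finset.mem_coe.1 hj))
  · refine Submodule.sum_mem _ fun j _ => ?_
    by_cases hj : j ∈ (P.activeStar q x).erase i
    · exact Submodule.smul_mem _ _ (Submodule.subset_span ⟨j, hj, rfl⟩)
    · have : l j = 0 := by
        by_cases hji : j = i
        · rw [hji, hli]
        · have hj' : j ∉ P.activeStar q x := fun h => hj (Finset.mem_erase.2 ⟨hji, h⟩)
          rw [mem_active] at hj'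
          exact (mul_eq_zero.1 (h2 j)).resolve_right (sub_ne_zero.2 hj')
      rw [this, zero_smul]
      exact Submodule.zero_mem _
  · rw [← sub_eq_zero, ← h1]
    abel

end LowerLevel.Regular

/-! ### Matrices as derivatives. -/

section Jacobians

variable {m n : Type*} [Fintype m] [Fintype n] [DecidableEq n]

/-- The continuous linear map between Euclidean spaces given by a matrix. -/
noncomputable def matrixCLM (J : Matrix m n ℝ) : EuclideanSpace ℝ n →L[ℝ] EuclideanSpace ℝ m :=
  LinearMap.toContinuousLinearMap (Matrix.toEuclideanLin J)

theorem matrixCLM_apply (J : Matrix m n ℝ) (u : EuclideanSpace ℝ n) :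
    matrixCLM J u = WithLp.toLp 2 (J *ᵥ u.ofLp) := rfl

theorem jacobian_eq_of_hasFDerivAt {F : EuclideanSpace ℝ n → EuclideanSpace ℝ m}
    {x : EuclideanSpace ℝ n} {J : Matrix m n ℝ} (h : HasFDerivAt F (matrixCLM J) x) :
    jacobian F x = J := by
  ext i j
  rw [jacobian, Matrix.of_apply, h.fderiv, matrixCLM_apply]
  simp

theorem hasFDerivAt_matrixCLM_jacobian {F : EuclideanSpace ℝ n → EuclideanSpace ℝ m}
    {x : EuclideanSpace ℝ n} (h : DifferentiableAt ℝ F x) :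
    HasFDerivAt F (matrixCLM (jacobian F x)) x := by
  obtain ⟨J, hJ⟩ : ∃ J : Matrix m n ℝ, matrixCLM J = fderiv ℝ F x :=
    ⟨Matrix.toEuclideanLin.symm (fderiv ℝ F x).toLinearMap, by
      ext1 u
      simp [matrixCLM]⟩
  have h' := h.hasFDerivAt
  rw [← hJ] at h'
  rwa [jacobian_eq_of_hasFDerivAt h']

theorem inner_transpose_mulVec [DecidableEq m] (J : Matrix m n ℝ) (v : EuclideanSpace ℝ m)
    (u : EuclideanSpace ℝ n) :
    inner ℝ (WithLp.toLp 2 (Jᵀ *ᵥ v.ofLp)) u = inner ℝ v (matrixCLM J u) := by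
  rw [matrixCLM_apply, EuclideanSpace.inner_eq_star_dotProduct,
    EuclideanSpace.inner_eq_star_dotProduct]
  simp only [star_trivial]
  rw [Matrix.mulVec_transpose, dotProduct_comm, ← Matrix.dotProduct_mulVec, dotProduct_comm]

end Jacobians

/-! ### The linearized KKT system. -/

section SaddlePoint

variable {m n r : Type*} [Fintype m] [Fintype n] [Fintype r] [DecidableEq m] [DecidableEq n]

theorem isUnit_det_of_pos {H : Matrix n n ℝ} (hH : ∀ v, v ≠ 0 → 0 < v ⬝ᵥ H *ᵥ v) :
    IsUnit H.det := by
  rw [isUnit_iff_ne_zero, Ne, ← Matrix.exists_mulVec_eq_zero_iff]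
  rintro ⟨v, hv, h⟩
  have := hH v hv
  rw [h, dotProduct_zero] at this
  exact this.false

/-- With `w = H⁻¹ Aᵀ u`, the quadratic form at `u` equals `wᵀ H w`, and `w ≠ 0` because independent
rows make `Aᵀ` injective. Symmetry of `H` plays no role. -/
theorem isUnit_det_schur {H : Matrix n n ℝ} (hH : ∀ v, v ≠ 0 → 0 < v ⬝ᵥ H *ᵥ v)
    {A : Matrix m n ℝ} (hA : LinearIndependent ℝ A.row) : IsUnit (A * H⁻¹ * Aᵀ).det := by
  have hdet := isUnit_det_of_pos hH
  refine isUnit_det_of_pos fun u hu => ?_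
  set w := H⁻¹ *ᵥ (Aᵀ *ᵥ u) with hw
  have hHw : H *ᵥ w = Aᵀ *ᵥ u := by
    rw [hw, Matrix.mulVec_mulVec, Matrix.mul_nonsing_inv _ hdet, Matrix.one_mulVec]
  have hw0 : w ≠ 0 := by
    intro h0
    rw [h0, Matrix.mulVec_zero, Matrix.mulVec_transpose] at hHw
    refine hu (Matrix.vecMul_injective_iff.2 hA ?_)
    simp only [← hHw, Matrix.zero_vecMul]
  have h := hH w hw0
  have : u ⬝ᵥ (A * H⁻¹ * Aᵀ) *ᵥ u = w ⬝ᵥ H *ᵥ w := by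
    rw [← Matrix.mulVec_mulVec, ← Matrix.mulVec_mulVec, ← hw, hHw, Matrix.mulVec_transpose,
      Matrix.dotProduct_mulVec, dotProduct_comm]
  rwa [this]

/-- Solution of the linearized optimality system by block elimination. -/
theorem saddle_point_solution {H : Matrix n n ℝ} {A : Matrix m n ℝ} {M : Matrix n r ℝ}
    {B : Matrix m r ℝ} (hH : IsUnit H.det) (hN : IsUnit (A * H⁻¹ * Aᵀ).det)
    {u : r → ℝ} {v e : n → ℝ} {l : m → ℝ} {Jl : Matrix m r ℝ}
    (hJl : Jl = -((A * H⁻¹ * Aᵀ)⁻¹ * (A * H⁻¹ * M - B)))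
    (h1 : H *ᵥ v + M *ᵥ u + Aᵀ *ᵥ l = e) (h2 : A *ᵥ v + B *ᵥ u = 0) :
    l - Jl *ᵥ u = ((A * H⁻¹ * Aᵀ)⁻¹ * (A * H⁻¹)) *ᵥ e ∧
      v - (H⁻¹ * (-M - Aᵀ * Jl)) *ᵥ u =
        (H⁻¹ - H⁻¹ * Aᵀ * ((A * H⁻¹ * Aᵀ)⁻¹ * (A * H⁻¹))) *ᵥ e := by
  have hv : v = H⁻¹ *ᵥ e - (H⁻¹ * M) *ᵥ u - (H⁻¹ * Aᵀ) *ᵥ l := by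
    rw [← h1]
    simp only [Matrix.mulVec_add, Matrix.mulVec_mulVec, Matrix.nonsing_inv_mul _ hH,
      Matrix.one_mulVec]
    abel
  have hl : l - Jl *ᵥ u = ((A * H⁻¹ * Aᵀ)⁻¹ * (A * H⁻¹)) *ᵥ e := by
    have h3 : (A * H⁻¹ * Aᵀ) *ᵥ l = (A * H⁻¹) *ᵥ e - (A * H⁻¹ * M - B) *ᵥ u := by
      have h4 := h2
      rw [hv] at h4
      simp only [Matrix.mulVec_sub, Matrix.mulVec_mulVec, ← Matrix.mul_assoc] at h4
      rw [Matrix.sub_mulVec, ← sub_eq_zero, ← neg_eq_zero, ← h4]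
      abel
    have h5 : l = (A * H⁻¹ * Aᵀ)⁻¹ *ᵥ ((A * H⁻¹ * Aᵀ) *ᵥ l) := by
      rw [Matrix.mulVec_mulVec, Matrix.nonsing_inv_mul _ hN, Matrix.one_mulVec]
    rw [h5, h3, hJl, Matrix.neg_mulVec, Matrix.mulVec_sub, Matrix.mulVec_mulVec,
      Matrix.mulVec_mulVec]
    abel
  refine ⟨hl, ?_⟩
  rw [Matrix.sub_mulVec, ← Matrix.mulVec_mulVec _ (H⁻¹ * Aᵀ), ← hl, Matrix.mulVec_sub]
  nth_rw 1 [hv]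
  simp only [Matrix.mul_sub, Matrix.sub_mulVec, Matrix.mul_neg, Matrix.neg_mulVec,
    Matrix.mulVec_mulVec, Matrix.mul_assoc]
  abel

end SaddlePoint

/-! ### Local stability of the active set and differentiability of the solution. -/

namespace LowerLevel

variable {du dl k : ℕ} {P : LowerLevel du dl k} {μ : ℝ}

theorem linearIndepOn_rowA_iff (S : Finset (Fin k)) :
    LinearIndepOn ℝ P.rowA (S : Set (Fin k)) ↔
      LinearIndependent ℝ (P.A.submatrix (fun i : S => (i : Fin k)) id).row := by
  have : (P.A.submatrix (fun i : S => (i : Fin k)) id).row =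
      (WithLp.linearEquiv 2 ℝ (Fin dl → ℝ)).toLinearMap ∘ fun i : S => P.rowA i := rfl
  rw [this, LinearMap.linearIndependent_iff _ (LinearEquiv.ker _)]
  rfl

namespace Regular

theorem isMultiplier_multiplier (hP : P.Regular μ) (q : EuclideanSpace ℝ (Fin dl))
    (x : EuclideanSpace ℝ (Fin du)) : P.IsMultiplier q x (P.ystar q x) (P.multiplier q x) := by
  obtain ⟨-, l, -, -, h⟩ := hP.exists_isMultiplier q x
  exact Classical.epsilon_spec ⟨l, h⟩

theorem multiplier_eq_zero (hP : P.Regular μ) {q : EuclideanSpace ℝ (Fin dl)}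
    {x : EuclideanSpace ℝ (Fin du)} {i : Fin k} (hi : i ∉ P.activeStar q x) :
    P.multiplier q x i = 0 := by
  obtain ⟨-, h2, -, -⟩ := hP.isMultiplier_iff.1 (hP.isMultiplier_multiplier q x)
  rw [mem_active] at hi
  exact (mul_eq_zero.1 (h2 i)).resolve_right (sub_ne_zero.2 hi)

theorem continuous_ystar_right (hP : P.Regular μ) (q : EuclideanSpace ℝ (Fin dl)) :
    Continuous (P.ystar q) :=
  hP.continuous_ystar.comp (f := fun x => (q, x)) (by fun_prop)

/-- Slack constraints stay slack nearby, by continuity. -/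
theorem eventually_activeStar_subset (hP : P.Regular μ) (q : EuclideanSpace ℝ (Fin dl))
    (x : EuclideanSpace ℝ (Fin du)) : ∀ᶠ x' in 𝓝 x, P.activeStar q x' ⊆ P.activeStar q x := by
  have hc := hP.continuous_ystar_right q
  have : ∀ᶠ x' in 𝓝 x, ∀ i, i ∉ P.activeStar q x → i ∉ P.activeStar q x' := by
    refine eventually_all.2 fun i => ?_
    by_cases hi : i ∈ P.activeStar q x
    · exact Eventually.of_forall fun _ h => absurd hi h
    · rw [mem_active] at hi
      have hcont : Continuous fun x' =>
          (inner ℝ (P.rowA i) (P.ystar q x') + inner ℝ (P.rowB i) x' : ℝ) := by fun_prop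
      filter_upwards [hcont.continuousAt.eventually_ne hi] with x' hx' _
      rwa [mem_active]
  filter_upwards [this] with x' hx' i hi
  by_contra h
  exact hx' i h hi

theorem continuous_gradY_ystar (hP : P.Regular μ) (q : EuclideanSpace ℝ (Fin dl)) :
    Continuous fun x => gradY P.g x (P.ystar q x) :=
  (contDiff_gradY hP.contDiff).continuous.comp (f := fun x => (x, P.ystar q x))
    (continuous_id.prodMk (hP.continuous_ystar_right q))

/-- Nearby active sets lie in the one at `x`, so multiplier differences are supported on independent
rows and are bounded by the change of `∇_y g`. -/
theorem continuousAt_multiplier (hP : P.Regular μ) {q : EuclideanSpace ℝ (Fin dl)}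
    {x : EuclideanSpace ℝ (Fin du)}
    (hlin : LinearIndepOn ℝ P.rowA (P.activeStar q x : Set (Fin k))) :
    ContinuousAt (P.multiplier q) x := by
  obtain ⟨K, hK0, hK⟩ := exists_norm_le_norm_sum_smul P.rowA
  rw [ContinuousAt, tendsto_iff_norm_sub_tendsto_zero]
  have hG := hP.continuous_gradY_ystar q
  have hlim : Tendsto (fun x' => K * ‖gradY P.g x' (P.ystar q x') - gradY P.g x (P.ystar q x)‖)
      (𝓝 x) (𝓝 0) := by
    have : Continuous fun x' =>
      K * ‖gradY P.g x' (P.ystar q x') - gradY P.g x (P.ystar q x)‖ := by fun_prop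
    simpa using this.tendsto x
  refine squeeze_zero' (Eventually.of_forall fun _ => norm_nonneg _) ?_ hlim
  filter_upwards [hP.eventually_activeStar_subset q x] with x' hx'
  have h1 := (hP.isMultiplier_iff.1 (hP.isMultiplier_multiplier q x')).1
  have h2 := (hP.isMultiplier_iff.1 (hP.isMultiplier_multiplier q x)).1
  have h3 : ∑ i, (P.multiplier q x' - P.multiplier q x) i • P.rowA i =
      -(gradY P.g x' (P.ystar q x') - gradY P.g x (P.ystar q x)) := by
    simp only [Pi.sub_apply, sub_smul, Finset.sum_sub_distrib]
    rw [← sub_eq_zero, ← sub_eq_zero.2 (h1.trans h2.symm)]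
    abel
  refine (hK _ hlin _ fun i hi => ?_).trans_eq (by rw [h3, norm_neg])
  rw [Pi.sub_apply, hP.multiplier_eq_zero hi, hP.multiplier_eq_zero fun h => hi (hx' h), sub_zero]

/-- Under linear independence and strict complementarity the active set is locally constant. -/
theorem eventually_activeStar_eq (hP : P.Regular μ) {q : EuclideanSpace ℝ (Fin dl)}
    {x : EuclideanSpace ℝ (Fin du)}
    (hlin : LinearIndepOn ℝ P.rowA (P.activeStar q x : Set (Fin k)))
    (hpos : ∀ i ∈ P.activeStar q x, 0 < P.multiplier q x i) :
    ∀ᶠ x' in 𝓝 x, P.activeStar q x' = P.activeStar q x := by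
  have hc := hP.continuousAt_multiplier hlin
  -- A positive multiplier stays positive, and complementarity then keeps its constraint active.
  have : ∀ᶠ x' in 𝓝 x, ∀ i, i ∈ P.activeStar q x → 0 < P.multiplier q x' i := by
    refine eventually_all.2 fun i => ?_
    by_cases hi : i ∈ P.activeStar q x
    · filter_upwards [((continuous_apply i).continuousAt.comp hc).eventually_const_lt
        (hpos i hi)] with x' hx' _ using hx'
    · exact Eventually.of_forall fun _ h => absurd h hi
  filter_upwards [hP.eventually_activeStar_subset q x, this] with x' h1 h2
  refine h1.antisymm fun i hi => ?_
  by_contra h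
  exact (h2 i hi).ne' (hP.multiplier_eq_zero h)

theorem hasFDerivAt_gradY (hP : P.Regular μ) (x : EuclideanSpace ℝ (Fin du))
    (y : EuclideanSpace ℝ (Fin dl)) :
    HasFDerivAt (Function.uncurry (gradY P.g))
      ((matrixCLM (hessXY P.g x y)).comp (ContinuousLinearMap.fst ℝ _ _) +
        (matrixCLM (hessYY P.g x y)).comp (ContinuousLinearMap.snd ℝ _ _)) (x, y) := by
  have h := ((contDiff_gradY hP.contDiff).differentiable one_ne_zero (x, y)).hasFDerivAt
  have h1 : HasFDerivAt (fun x' => gradY P.g x' y) _ x :=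
    h.comp (f := fun x' => (x', y)) x (hasFDerivAt_prodMk_left x y)
  have h2 : HasFDerivAt (fun y' => gradY P.g x y') _ y :=
    h.comp (f := fun y' => (x, y')) y (hasFDerivAt_prodMk_right x y)
  have e1 := h1.unique (hasFDerivAt_matrixCLM_jacobian h1.differentiableAt)
  have e2 := h2.unique (hasFDerivAt_matrixCLM_jacobian h2.differentiableAt)
  have key : (matrixCLM (hessXY P.g x y)).comp (ContinuousLinearMap.fst ℝ _ _) +
      (matrixCLM (hessYY P.g x y)).comp (ContinuousLinearMap.snd ℝ _ _) =
      fderiv ℝ (Function.uncurry (gradY P.g)) (x, y) := by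
    refine ContinuousLinearMap.ext fun p => ?_
    have e1' := DFunLike.congr_fun e1 p.1
    have e2' := DFunLike.congr_fun e2 p.2
    refine (congrArg₂ (· + ·) e1'.symm e2'.symm).trans ?_
    simp only [ContinuousLinearMap.comp_apply, ← map_add]
    simp
  rw [key]
  exact h

theorem hasFDerivAt_gradY_right (hP : P.Regular μ) (x : EuclideanSpace ℝ (Fin du))
    (y : EuclideanSpace ℝ (Fin dl)) :
    HasFDerivAt (gradY P.g x) (matrixCLM (hessYY P.g x y)) y := by
  have h := (hP.hasFDerivAt_gradY x y).comp (f := fun y' => (x, y')) y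
    (hasFDerivAt_prodMk_right x y)
  have key : ((matrixCLM (hessXY P.g x y)).comp (ContinuousLinearMap.fst ℝ _ _) +
      (matrixCLM (hessYY P.g x y)).comp (ContinuousLinearMap.snd ℝ _ _)).comp
      (ContinuousLinearMap.inr ℝ (EuclideanSpace ℝ (Fin du)) (EuclideanSpace ℝ (Fin dl))) =
      matrixCLM (hessYY P.g x y) := by
    refine ContinuousLinearMap.ext fun v => ?_
    simp
  rw [key] at h
  exact h

/-- Strong monotonicity of `∇_y g` bounds the difference quotients along `v` below by `μ ‖v‖²`; pass
to the limit. -/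
theorem hessYY_pos (hP : P.Regular μ) (x : EuclideanSpace ℝ (Fin du))
    (y : EuclideanSpace ℝ (Fin dl)) (v : Fin dl → ℝ) (hv : v ≠ 0) :
    0 < v ⬝ᵥ hessYY P.g x y *ᵥ v := by
  set w : EuclideanSpace ℝ (Fin dl) := WithLp.toLp 2 v with hw
  have hw0 : w ≠ 0 := fun h => hv (by simpa [hw] using h)
  have h1 : HasDerivAt (fun t : ℝ => y + t • w) w 0 := by
    simpa using ((hasDerivAt_id (0 : ℝ)).smul_const w).const_add y
  have h2 : HasFDerivAt (gradY P.g x) (matrixCLM (hessYY P.g x y)) (y + (0 : ℝ) • w) := by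
    simpa using hP.hasFDerivAt_gradY_right x y
  have h3 : HasDerivAt (fun t : ℝ => gradY P.g x (y + t • w)) (matrixCLM (hessYY P.g x y) w) 0 :=
    h2.comp_hasDerivAt (0 : ℝ) h1
  have h4 : HasDerivAt (fun t : ℝ => (inner ℝ (gradY P.g x (y + t • w)) w : ℝ))
      (inner ℝ (matrixCLM (hessYY P.g x y) w) w) 0 := by
    simpa using h3.inner ℝ (hasDerivAt_const (0 : ℝ) w)
  have hslope := (hasDerivAt_iff_tendsto_slope.1 h4).mono_left (nhdsGT_le_nhdsNE 0)
  have hge : μ * ‖w‖ ^ 2 ≤ inner ℝ (matrixCLM (hessYY P.g x y) w) w := by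
    refine ge_of_tendsto hslope ?_
    filter_upwards [self_mem_nhdsWithin] with t (ht : 0 < t)
    have h := StrongConvexOn.le_inner_sub_of_hasGradientAt (hP.strongConvexOn x)
      (hP.hasGradientAt x (y + t • w)) (hP.hasGradientAt x y)
    rw [add_sub_cancel_left, norm_smul, inner_smul_right, Real.norm_of_nonneg ht.le, mul_pow,
      inner_sub_left] at h
    rw [slope_def_field, sub_zero, zero_smul, add_zero, le_div_iff₀ ht]
    refine le_of_mul_le_mul_left ?_ ht
    linarith
  have hpos : 0 < μ * ‖w‖ ^ 2 := mul_pos hP.pos (pow_pos (norm_pos_iff.2 hw0) 2)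
  refine (hpos.trans_le hge).trans_eq ?_
  rw [matrixCLM_apply, EuclideanSpace.inner_eq_star_dotProduct]
  simp [hw]

/-- Differentiability of the solution map and of the active multipliers. -/
theorem hasFDerivAt_ystar_multiplierOn (hP : P.Regular μ) {q : EuclideanSpace ℝ (Fin dl)}
    {x : EuclideanSpace ℝ (Fin du)} (hlin : LinearIndependent ℝ (P.Abar q x).row)
    (hpos : ∀ i ∈ P.activeStar q x, 0 < P.multiplier q x i)
    {Jl : Matrix (P.activeStar q x) (Fin du) ℝ}
    (hJl : Jl = -((P.Abar q x * (P.H q x)⁻¹ * (P.Abar q x)ᵀ)⁻¹ *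
      (P.Abar q x * (P.H q x)⁻¹ * P.M q x - P.Bbar q x))) :
    HasFDerivAt (P.multiplierOn (P.activeStar q x) q) (matrixCLM Jl) x ∧
      HasFDerivAt (P.ystar q)
        (matrixCLM ((P.H q x)⁻¹ * (-P.M q x - (P.Abar q x)ᵀ * Jl))) x := by
  have hlin' := (linearIndepOn_rowA_iff (P.activeStar q x)).2 hlin
  have hH : IsUnit (P.H q x).det := isUnit_det_of_pos (hP.hessYY_pos x _)
  have hN : IsUnit (P.Abar q x * (P.H q x)⁻¹ * (P.Abar q x)ᵀ).det :=
    isUnit_det_schur (hP.hessYY_pos x _) hlin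
  set y := P.ystar q x with hy
  -- the remainder of the linearized stationarity condition
  set e : EuclideanSpace ℝ (Fin du) → EuclideanSpace ℝ (Fin dl) := fun x' =>
    -(gradY P.g x' (P.ystar q x') - gradY P.g x y - (matrixCLM (P.M q x) (x' - x) +
      matrixCLM (P.H q x) (P.ystar q x' - y))) with he
  have hO : (fun x' => P.ystar q x' - y) =O[𝓝 x] fun x' => x' - x := by
    obtain ⟨C, -, hC⟩ := hP.exists_lipschitz_ystar (‖x‖ + 1)
    refine IsBigO.of_bound C ?_
    filter_upwards [Metric.ball_mem_nhds x one_pos] with x' hx'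
    refine hC q x' ?_ x (by simp)
    rw [mem_ball_iff_norm] at hx'
    rw [mem_closedBall_zero_iff]
    linarith [norm_sub_norm_le x' x]
  have heo : e =o[𝓝 x] fun x' => x' - x := by
    have h1 := (hP.hasFDerivAt_gradY x y).isLittleO
    have ht : Tendsto (fun x' => (x', P.ystar q x')) (𝓝 x) (𝓝 (x, y)) :=
      (continuous_id.prodMk (hP.continuous_ystar_right q)).tendsto x
    have h2 := (h1.comp_tendsto ht).neg_left
    exact h2.trans_isBigO ((isBigO_refl _ _).prod_left hO)
  -- Where the active set agrees with that at `x`, subtracting the KKT equations gives an exact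
  -- linear system with right-hand side `(e, 0)`.
  have hsys : ∀ᶠ x' in 𝓝 x,
      (P.H q x *ᵥ (P.ystar q x' - y).ofLp + P.M q x *ᵥ (x' - x).ofLp +
        (P.Abar q x)ᵀ *ᵥ (P.multiplierOn (P.activeStar q x) q x' -
          P.multiplierOn (P.activeStar q x) q x).ofLp = (e x').ofLp) ∧
      P.Abar q x *ᵥ (P.ystar q x' - y).ofLp + P.Bbar q x *ᵥ (x' - x).ofLp = 0 := by
    filter_upwards [hP.eventually_activeStar_eq hlin' hpos] with x' hx'
    have h1 := (hP.isMultiplier_iff.1 (hP.isMultiplier_multiplier q x')).1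
    have h2 := (hP.isMultiplier_iff.1 (hP.isMultiplier_multiplier q x)).1
    constructor
    · have hsum : WithLp.toLp 2
          ((P.Abar q x)ᵀ *ᵥ (P.multiplierOn (P.activeStar q x) q x' -
            P.multiplierOn (P.activeStar q x) q x).ofLp) =
          ∑ i, (P.multiplier q x' - P.multiplier q x) i • P.rowA i := by
        rw [sum_smul_eq_sum_of_supported (S := P.activeStar q x),
          ← Finset.sum_coe_sort (P.activeStar q x)]
        · ext j
          simp [Matrix.mulVec, dotProduct, Abar, rowA, multiplierOn, mul_comm]
        · intro i hi
          rw [Pi.sub_apply, hP.multiplier_eq_zero hi,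
            hP.multiplier_eq_zero (q := q) (x := x') (by rwa [hx']), sub_zero]
      have h3 : ∑ i, (P.multiplier q x' - P.multiplier q x) i • P.rowA i =
          -(gradY P.g x' (P.ystar q x') - gradY P.g x y) := by
        simp only [Pi.sub_apply, sub_smul, Finset.sum_sub_distrib]
        rw [← sub_eq_zero, ← sub_eq_zero.2 (h1.trans h2.symm)]
        abel
      have h4 : e x' = matrixCLM (P.H q x) (P.ystar q x' - y) + matrixCLM (P.M q x) (x' - x) +
          ∑ i, (P.multiplier q x' - P.multiplier q x) i • P.rowA i := by
        rw [h3]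
        simp only [he]
        abel
      rw [h4, ← hsum]
      rfl
    · funext i
      have a1 := P.mem_active.1 i.2
      have a2 : (i : Fin k) ∈ P.activeStar q x' := by
        rw [hx']
        exact i.2
      rw [mem_active] at a2
      have b1 : (P.Abar q x *ᵥ (P.ystar q x' - y).ofLp) i =
          inner ℝ (P.rowA i) (P.ystar q x' - y) := P.A_mulVec _ _
      have b2 : (P.Bbar q x *ᵥ (x' - x).ofLp) i = inner ℝ (P.rowB i) (x' - x) := P.B_mulVec _ _
      rw [Pi.add_apply, b1, b2, inner_sub_right, inner_sub_right, Pi.zero_apply]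
      linarith
  constructor
  · refine HasFDerivAt.of_isLittleO ?_
    -- The error of the candidate derivative is a fixed linear image of `e`, hence `o(‖x' - x‖)`.
    refine (((matrixCLM ((P.Abar q x * (P.H q x)⁻¹ * (P.Abar q x)ᵀ)⁻¹ *
      (P.Abar q x * (P.H q x)⁻¹))).isBigO_comp e (𝓝 x)).trans_isLittleO heo).congr' ?_
      EventuallyEq.rfl
    filter_upwards [hsys] with x' hx'
    have := (saddle_point_solution hH hN hJl hx'.1 hx'.2).1
    exact (congrArg (WithLp.toLp 2) this).symm
  · refine HasFDerivAt.of_isLittleO ?_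
    refine (((matrixCLM ((P.H q x)⁻¹ - (P.H q x)⁻¹ * (P.Abar q x)ᵀ *
      ((P.Abar q x * (P.H q x)⁻¹ * (P.Abar q x)ᵀ)⁻¹ *
      (P.Abar q x * (P.H q x)⁻¹)))).isBigO_comp e (𝓝 x)).trans_isLittleO heo).congr' ?_
      EventuallyEq.rfl
    filter_upwards [hsys] with x' hx'
    have := (saddle_point_solution hH hN hJl hx'.1 hx'.2).2
    exact (congrArg (WithLp.toLp 2) this).symm

end Regular

end LowerLevel

/-! ### Gradients under the integral sign. -/

section Gradient

variable {α E : Type*} [MeasurableSpace α] [NormedAddCommGroup E] [InnerProductSpace ℝ E]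
  [CompleteSpace E]

theorem integrable_toDual_symm {ν : Measure α} {φ : α → StrongDual ℝ E} (hφ : Integrable φ ν) :
    Integrable (fun a => (InnerProductSpace.toDual ℝ E).symm (φ a)) ν :=
  hφ.mono ((InnerProductSpace.toDual ℝ E).symm.continuous.comp_aestronglyMeasurable
    hφ.aestronglyMeasurable) (Eventually.of_forall fun a => by
      rw [LinearIsometryEquiv.norm_map])

theorem toDual_symm_integral {ν : Measure α} {φ : α → StrongDual ℝ E} (hφ : Integrable φ ν) :
    (InnerProductSpace.toDual ℝ E).symm (∫ a, φ a ∂ν) =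
      ∫ a, (InnerProductSpace.toDual ℝ E).symm (φ a) ∂ν := by
  refine ext_inner_right ℝ fun v => ?_
  rw [InnerProductSpace.toDual_symm_apply, ContinuousLinearMap.integral_apply hφ, real_inner_comm,
    ← integral_inner (integrable_toDual_symm hφ)]
  refine integral_congr_ae (Eventually.of_forall fun a => ?_)
  simp only
  rw [real_inner_comm, InnerProductSpace.toDual_symm_apply]

end Gradient

/-! ### Chain rule and differentiation under the expectation. -/

namespace LowerLevel.Regular

variable {du dl k : ℕ} {P : LowerLevel du dl k} {μ : ℝ}
  {f : EuclideanSpace ℝ (Fin du) → EuclideanSpace ℝ (Fin dl) → ℝ}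

theorem continuous_implicitFun (hP : P.Regular μ) (hf : ContDiff ℝ 1 (Function.uncurry f)) :
    Continuous (Function.uncurry (P.implicitFun f)) :=
  hf.continuous.comp (f := fun p : EuclideanSpace ℝ (Fin dl) × EuclideanSpace ℝ (Fin du) =>
    (p.2, P.ystar p.1 p.2)) (continuous_snd.prodMk hP.continuous_ystar)

/-- On every ball the implicit functions are Lipschitz and bounded, uniformly in `q`. -/
theorem exists_lipschitz_implicitFun (hP : P.Regular μ) (hf : ContDiff ℝ 1 (Function.uncurry f))
    (R : ℝ) : ∃ C : ℝ, 0 ≤ C ∧ ∀ q : EuclideanSpace ℝ (Fin dl),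
      ∀ x₁ ∈ Metric.closedBall (0 : EuclideanSpace ℝ (Fin du)) R, ‖P.implicitFun f q x₁‖ ≤ C ∧
      ∀ x₂ ∈ Metric.closedBall (0 : EuclideanSpace ℝ (Fin du)) R,
        ‖P.implicitFun f q x₁ - P.implicitFun f q x₂‖ ≤ C * ‖x₁ - x₂‖ := by
  obtain ⟨ρ, hρ⟩ := hP.exists_feasible_subset_closedBall R
  obtain ⟨C, hC0, hC⟩ := hP.exists_lipschitz_ystar R
  have hD := (isCompact_closedBall (0 : EuclideanSpace ℝ (Fin du)) R).prod
    (isCompact_closedBall (0 : EuclideanSpace ℝ (Fin dl)) ρ)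
  obtain ⟨L, hL⟩ := hf.contDiffOn.exists_lipschitzOnWith one_ne_zero
    ((convex_closedBall _ _).prod (convex_closedBall _ _)) hD
  obtain ⟨Γ, hΓ⟩ := (hD.image hf.continuous).isBounded.exists_norm_le
  have hmem : ∀ q, ∀ x ∈ Metric.closedBall (0 : EuclideanSpace ℝ (Fin du)) R,
      (x, P.ystar q x) ∈ Metric.closedBall (0 : EuclideanSpace ℝ (Fin du)) R ×ˢ
        Metric.closedBall (0 : EuclideanSpace ℝ (Fin dl)) ρ :=
    fun q x hx => ⟨hx, hρ x hx (hP.ystar_mem q x)⟩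
  refine ⟨max Γ (L * (1 + C)), le_max_of_le_right (by positivity), fun q x₁ hx₁ =>
    ⟨(hΓ _ ⟨_, hmem q x₁ hx₁, rfl⟩).trans (le_max_left _ _), fun x₂ hx₂ => ?_⟩⟩
  have h1 := hL.norm_sub_le (hmem q x₁ hx₁) (hmem q x₂ hx₂)
  have h2 : ‖(x₁, P.ystar q x₁) - (x₂, P.ystar q x₂)‖ ≤ (1 + C) * ‖x₁ - x₂‖ := by
    rw [Prod.mk_sub_mk, Prod.norm_mk, add_mul, one_mul]
    have h3 := hC q x₁ hx₁ x₂ hx₂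
    have h4 := norm_nonneg (x₁ - x₂)
    exact max_le (le_add_of_nonneg_right (mul_nonneg hC0 h4))
      (h3.trans (le_add_of_nonneg_left h4))
  calc ‖P.implicitFun f q x₁ - P.implicitFun f q x₂‖
      ≤ L * ‖(x₁, P.ystar q x₁) - (x₂, P.ystar q x₂)‖ := h1
    _ ≤ L * ((1 + C) * ‖x₁ - x₂‖) := by gcongr
    _ ≤ _ := by
      rw [← mul_assoc]
      gcongr
      exact le_max_right _ _

/-- Chain rule for the implicit function. -/
theorem hasGradientAt_implicitFun (hf : ContDiff ℝ 1 (Function.uncurry f))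
    {q : EuclideanSpace ℝ (Fin dl)} {x : EuclideanSpace ℝ (Fin du)}
    (hy : DifferentiableAt ℝ (P.ystar q) x) :
    HasGradientAt (P.implicitFun f q) (gradX f x (P.ystar q x) +
      WithLp.toLp 2 ((jacobian (P.ystar q) x)ᵀ *ᵥ (gradY f x (P.ystar q x)).ofLp)) x := by
  have h1 := ((hf.differentiable one_ne_zero) (x, P.ystar q x)).hasFDerivAt
  have h2 := h1.comp (f := fun x' => (x', P.ystar q x')) x
    ((hasFDerivAt_id x).prodMk (hasFDerivAt_matrixCLM_jacobian hy))
  rw [hasGradientAt_iff_hasFDerivAt]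
  refine h2.congr_fderiv (ContinuousLinearMap.ext fun u => ?_)
  rw [InnerProductSpace.toDual_apply_apply, inner_add_left, inner_transpose_mulVec,
    ← fderiv_uncurry_apply hf]
  rfl

/-- Differentiation under the expectation over the perturbation. -/
theorem smoothedFun_gradient (hP : P.Regular μ) (hf : ContDiff ℝ 1 (Function.uncurry f))
    (Q : Measure (EuclideanSpace ℝ (Fin dl))) [IsProbabilityMeasure Q]
    {x : EuclideanSpace ℝ (Fin du)} (hy : ∀ᵐ q ∂Q, DifferentiableAt ℝ (P.ystar q) x) :
    Integrable (fun q => P.implicitFun f q x) Q ∧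
      DifferentiableAt ℝ (P.smoothedFun f Q) x ∧
      Integrable (fun q => gradient (P.implicitFun f q) x) Q ∧
      gradient (P.smoothedFun f Q) x = ∫ q, gradient (P.implicitFun f q) x ∂Q ∧
      ∀ᵐ q ∂Q, DifferentiableAt ℝ (P.implicitFun f q) x ∧
        gradient (P.implicitFun f q) x =
          gradX f x (P.ystar q x) +
            WithLp.toLp 2
              ((jacobian (P.ystar q) x)ᵀ *ᵥ (gradY f x (P.ystar q x)).ofLp) := by
  have hgrad : ∀ᵐ q ∂Q, HasGradientAt (P.implicitFun f q) (gradX f x (P.ystar q x) +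
      WithLp.toLp 2 ((jacobian (P.ystar q) x)ᵀ *ᵥ (gradY f x (P.ystar q x)).ofLp)) x := by
    filter_upwards [hy] with q hq using hasGradientAt_implicitFun hf hq
  obtain ⟨C, hC0, hC⟩ := hP.exists_lipschitz_implicitFun hf (‖x‖ + 1)
  have hcont := hP.continuous_implicitFun hf
  have hx : x ∈ Metric.closedBall (0 : EuclideanSpace ℝ (Fin du)) (‖x‖ + 1) := by simp
  have hball : Metric.ball x 1 ⊆ Metric.closedBall 0 (‖x‖ + 1) := by
    intro x' hx'
    rw [mem_ball_iff_norm] at hx'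
    rw [mem_closedBall_zero_iff]
    linarith [norm_sub_norm_le x' x]
  have hmeas : ∀ x', AEStronglyMeasurable (fun q => P.implicitFun f q x') Q := fun x' =>
    (hcont.comp (f := fun q => (q, x')) (by fun_prop)).aestronglyMeasurable
  have hint : Integrable (fun q => P.implicitFun f q x) Q :=
    Integrable.of_bound (hmeas x) C (Eventually.of_forall fun q => (hC q x hx).1)
  -- Joint continuity in `(q, x)` suffices for measurability of the derivative in `q`, even where it
  -- takes its default value.
  have hmeas' : AEStronglyMeasurable (fun q => fderiv ℝ (P.implicitFun f q) x) Q :=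
    ((measurable_fderiv_with_param ℝ hcont).comp
      (measurable_id.prodMk measurable_const)).aestronglyMeasurable
  -- Only differentiability at `x` for almost every `q` is available; the exceptional set varies
  -- with `x`. This version asks for no more, given the constant Lipschitz bound.
  obtain ⟨hint', hderiv⟩ := hasFDerivAt_integral_of_dominated_loc_of_lip'
    (F := fun x' q => P.implicitFun f q x') (bound := fun _ => C)
    (Metric.ball_mem_nhds x one_pos) (fun x' _ => hmeas x') hint hmeas'
    (Eventually.of_forall fun q x' hx' => (hC q x' (hball hx')).2 x hx) (integrable_const C)
    (by filter_upwards [hgrad] with q hq using hq.differentiableAt.hasFDerivAt)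
  refine ⟨hint, hderiv.differentiableAt, integrable_toDual_symm hint', ?_, ?_⟩
  · refine Eq.trans ?_ (toDual_symm_integral hint')
    exact congrArg _ hderiv.fderiv
  · filter_upwards [hgrad] with q hq using ⟨hq.differentiableAt, hq.gradient⟩

end LowerLevel.Regular

end BilevelLC

theorem proposition2p5 {du dl k : ℕ}
    -- the lower-level problem: `g`, `A`, `B`, `b`
    (P : LowerLevel du dl k)
    -- the upper-level objective, an expectation of sampled objectives
    {Ξ : Type*} [MeasurableSpace Ξ] (D : Measure Ξ) [IsProbabilityMeasure D]
    (f : EuclideanSpace ℝ (Fin du) → EuclideanSpace ℝ (Fin dl) → ℝ)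
    (ftilde : Ξ → EuclideanSpace ℝ (Fin du) → EuclideanSpace ℝ (Fin dl) → ℝ)
    (hexp : ∀ x y, Integrable (fun ξ => ftilde ξ x y) D ∧ f x y = ∫ ξ, ftilde ξ x y ∂D)
    -- the continuous distribution of the perturbation
    (Q : Measure (EuclideanSpace ℝ (Fin dl))) [IsProbabilityMeasure Q] (hQ : Q ≪ volume)
    -- smoothness, compactness and strong convexity
    (hf : ContDiff ℝ 1 (Function.uncurry f))
    (hg : ContDiff ℝ 2 (Function.uncurry P.g))
    (hcompact : ∀ x, IsCompact (P.feasible x))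
    (μ : ℝ) (hμ : 0 < μ) (hconv : ∀ x, StrongConvexOn Set.univ μ (P.g x))
    -- strict feasibility and full row rank of the active constraints
    (hstrict : ∀ x : EuclideanSpace ℝ (Fin du), ∃ y : EuclideanSpace ℝ (Fin dl),
      ∀ i, (P.A *ᵥ y.ofLp) i + (P.B *ᵥ x.ofLp) i < P.b i)
    (hrank : ∀ x, ∀ᵐ q ∂Q, LinearIndependent ℝ (P.Abar q x).row)
    (x : EuclideanSpace ℝ (Fin du)) :
    -- `F̄` is differentiable and its gradient is the expectation of `∇ F_q`
    (Integrable (fun q => P.implicitFun f q x) Q ∧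
      DifferentiableAt ℝ (P.smoothedFun f Q) x ∧
      Integrable (fun q => gradient (P.implicitFun f q) x) Q ∧
      gradient (P.smoothedFun f Q) x = ∫ q, gradient (P.implicitFun f q) x ∂Q ∧
      ∀ᵐ q ∂Q, DifferentiableAt ℝ (P.implicitFun f q) x ∧
        gradient (P.implicitFun f q) x =
          gradX f x (P.ystar q x) +
            WithLp.toLp 2
              ((jacobian (P.ystar q) x)ᵀ *ᵥ (gradY f x (P.ystar q x)).ofLp)) ∧
    -- the same for every (continuously differentiable) sampled objective
    (∀ ξ, ContDiff ℝ 1 (Function.uncurry (ftilde ξ)) →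
      Integrable (fun q => P.implicitFun (ftilde ξ) q x) Q ∧
      DifferentiableAt ℝ (P.smoothedFun (ftilde ξ) Q) x ∧
      Integrable (fun q => gradient (P.implicitFun (ftilde ξ) q) x) Q ∧
      gradient (P.smoothedFun (ftilde ξ) Q) x =
        ∫ q, gradient (P.implicitFun (ftilde ξ) q) x ∂Q ∧
      ∀ᵐ q ∂Q, DifferentiableAt ℝ (P.implicitFun (ftilde ξ) q) x ∧
        gradient (P.implicitFun (ftilde ξ) q) x =
          gradX (ftilde ξ) x (P.ystar q x) +
            WithLp.toLp 2
              ((jacobian (P.ystar q) x)ᵀ *ᵥ (gradY (ftilde ξ) x (P.ystar q x)).ofLp)) ∧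
    -- the Jacobians of `y_q*` and of the multipliers of the active constraints
    (∀ᵐ q ∂Q,
      IsUnit (P.H q x).det ∧
      IsUnit (P.Abar q x * (P.H q x)⁻¹ * (P.Abar q x)ᵀ).det ∧
      DifferentiableAt ℝ (P.ystar q) x ∧
      DifferentiableAt ℝ (P.multiplierOn (P.activeStar q x) q) x ∧
      jacobian (P.ystar q) x =
        (P.H q x)⁻¹ *
          (-P.M q x - (P.Abar q x)ᵀ * jacobian (P.multiplierOn (P.activeStar q x) q) x) ∧
      jacobian (P.multiplierOn (P.activeStar q x) q) x =
        -((P.Abar q x * (P.H q x)⁻¹ * (P.Abar q x)ᵀ)⁻¹ *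
          (P.Abar q x * (P.H q x)⁻¹ * P.M q x - P.Bbar q x))) := by
  have hP : P.Regular μ := ⟨hg, hcompact, hμ, hconv, hstrict⟩
  -- Absolute continuity of `Q` transfers the Lebesgue-almost-everywhere statement.
  have hjac : ∀ᵐ q ∂Q,
      LinearIndependent ℝ (P.Abar q x).row ∧ ∀ i ∈ P.activeStar q x, 0 < P.multiplier q x i := by
    filter_upwards [hrank x, hQ.ae_le (hP.ae_strict_complementarity x)] with q hq hsc
    exact ⟨hq, hsc ((LowerLevel.linearIndepOn_rowA_iff _).2 hq) _ (hP.isMultiplier_multiplier q x)⟩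
  have hdiff : ∀ᵐ q ∂Q, DifferentiableAt ℝ (P.ystar q) x := by
    filter_upwards [hjac] with q hq
    exact (hP.hasFDerivAt_ystar_multiplierOn hq.1 hq.2 rfl).2.differentiableAt
  refine ⟨hP.smoothedFun_gradient hf Q hdiff, fun ξ hξ => hP.smoothedFun_gradient hξ Q hdiff, ?_⟩
  filter_upwards [hjac] with q hq
  obtain ⟨h1, h2⟩ := hP.hasFDerivAt_ystar_multiplierOn hq.1 hq.2 rfl
  refine ⟨isUnit_det_of_pos (hP.hessYY_pos x _), isUnit_det_schur (hP.hessYY_pos x _) hq.1,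
    h2.differentiableAt, h1.differentiableAt, ?_, jacobian_eq_of_hasFDerivAt h1⟩
  rw [jacobian_eq_of_hasFDerivAt h1]
  exact jacobian_eq_of_hasFDerivAt h2
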